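/- **Setting.** A *Cantor groupoid* is a Hausdorff, locally compact, second countable topological groupoid $G$ whose unit space $G^{(0)}$ is open in $G$, is nonempty, compact, totally disconnected and has no isolated points (so is homeomorphic to the Cantor set), and for which the counting measures form a Haar system, that is, $x \mapsto \sum_{r(g)=x} f(g)$ is continuous on $G^{(0)}$ for every $f \in C_c(G)$. Here $r(g) = gg^{-1}$ and $s(g) = g^{-1}g$. A groupoid is *principal* if $r(g)=s(g)$ only when $g$ is a unit. A Cantor groupoid is *AF* if it is the union of an increasing sequence of compact open principal Cantor subgroupoids, each of which contains the unit space. A *$G$-set* is a subset of $G$ on which both $r$ and $s$ are injective. A compact set $K \subseteq G^{(0)}$ is *thin* in $G$ if for every $n$ there are compact $G$-sets $S_1, \dots, S_n \subseteq G$ with $s(S_k) = K$ for all $k$ and with $r(S_1), \dots, r(S_n)$ pairwise disjoint. A Borel probability measure $\mu$ on $G^{(0)}$ is *$G$-invariant* if $$\int_{G^{(0)}} \sum_{r(g)=x} f(g) \, d\mu(x) = \int_{G^{(0)}} \sum_{s(g)=x} f(g) \, d\mu(x) \qquad \text{for all } f \in C_c(G).$$ The reduced C*-algebra $C^*_r(G)$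 is the completion of the convolution *-algebra $C_c(G)$ in the norm $\sup_{x \in G^{(0)}} \|\lambda_x(f)\|$, where $\lambda_x$ acts on $\ell^2(s^{-1}(x))$ by $(\lambda_x(f)\xi)(g) = \sum_{s(h)=x} f(gh^{-1})\xi(h)$. A *normalized trace* on a unital C*-algebra $A$ is a linear functional $\tau$ with $\tau(a^*a) \ge 0$ and $\tau(ab)=\tau(ba)$ for all $a, b \in A$, and with $\tau(1)=1$. **Proposition.** Let $G$ be a Cantor groupoid, and let $G_0 \subseteq G$ be an open AF subgroupoid which contains the unit space of $G$ and such that $s(K)$ is thin in $G_0$ for every compact set $K \subseteq G \setminus G_0$. Then the inclusion $C_c(G_0) \subseteq C_c(G)$ (extension by zero) extends to an injective unital *-homomorphism $\iota : C^*_r(G_0) \to C^*_r(G)$, and the following four sets are canonically in bijection: - $M$, the set of $G$-invariant Borel probability measures on $G^{(0)}$; - $M_0$, the set of $G_0$-invariant Borel probability measures on $G^{(0)}$; - $T(C^*_r(G))$, the set of normalized traces on $C^*_r(G)$; - $T(C^*_r(G_0))$, the set of normalized traces on $C^*_r(G_0)$. More precisely, the following maps are well defined and bijective, and they form a commutative square: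 the identity map $M \to M_0$, $\mu \mapsto \mu$; the restriction map $T(C^*_r(G)) \to T(C^*_r(G_0))$, $\tau \mapsto \tau \circ \iota$; and the maps $M \to T(C^*_r(G))$ and $M_0 \to T(C^*_r(G_0))$ which send $\mu$ to the normalized trace determined by $\tau(f) = \int_{G^{(0)}} f|_{G^{(0)}} \, d\mu$ for $f$ in $C_c(G)$, respectively in $C_c(G_0)$. -/

import Mathlib

open MeasureTheory CompactlySupported
open scoped ComplexOrder ENNReal lp

/-- An r-discrete topological groupoid. `G` is the space of arrows and `X` is the unit space; `X` is
identified with the subset `range unit` of `G` (`unit` is a topological embedding, having the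
continuous left inverse `r`). The product `mul g h` is defined exactly when `s g = r h`. -/
structure RDiscreteGroupoid (X G : Type*) [TopologicalSpace X] [TopologicalSpace G] where
  /-- the range map -/
  r : G → X
  /-- the source map -/
  s : G → X
  /-- the inclusion of the units -/
  unit : X → G
  /-- the inverse -/
  inv : G → G
  /-- the product of composable arrows -/
  mul : ∀ g h : G, s g = r h → G
  r_unit : ∀ x, r (unit x) = x
  s_unit : ∀ x, s (unit x) = x
  r_inv : ∀ g, r (inv g) = s g
  s_inv : ∀ g, s (inv g) = r g
  r_mul : ∀ g h (e : s g = r h), r (mul g h e) = r g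
  s_mul : ∀ g h (e : s g = r h), s (mul g h e) = s h
  unit_mul : ∀ g, mul (unit (r g)) g (s_unit (r g)) = g
  mul_unit : ∀ g, mul g (unit (s g)) (r_unit (s g)).symm = g
  inv_mul : ∀ g, mul (inv g) g (s_inv g) = unit (s g)
  mul_inv : ∀ g, mul g (inv g) (r_inv g).symm = unit (r g)
  mul_assoc : ∀ g h k (e₁ : s g = r h) (e₂ : s h = r k),
    mul (mul g h e₁) k ((s_mul g h e₁).trans e₂) = mul g (mul h k e₂) (e₁.trans (r_mul h k e₂).symm)
  continuous_r : Continuous r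
  continuous_s : Continuous s
  continuous_unit : Continuous unit
  continuous_inv : Continuous inv
  continuous_mul : Continuous fun p : {p : G × G // s p.1 = r p.2} => mul p.1.1 p.1.2 p.2
  /-- r-discreteness: the unit space is open in the arrow space -/
  isOpen_range_unit : IsOpen (Set.range unit)

namespace RDiscreteGroupoid

variable {X G : Type*} [TopologicalSpace X] [TopologicalSpace G] (𝒢 : RDiscreteGroupoid X G)

/-- The counting measures on the fibres `r⁻¹(x)` form a Haar system. (Left invariance and the
support condition are automatic for counting measures, so this is the continuity of
`x ↦ ∫ f dλˣ = ∑_{r(g) = x} f(g)` for all `f ∈ C_c(G)`; these sums are finite.) -/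
def CountingIsHaar : Prop :=
  ∀ f : C_c(G, ℂ), Continuous fun x : X => ∑' g : {g : G // 𝒢.r g = x}, f g

/-- Cantor groupoids, equipped with the Haar system of counting measures. -/
structure IsCantor : Prop where
  t2Space : T2Space G
  locallyCompactSpace : LocallyCompactSpace G
  secondCountableTopology : SecondCountableTopology G
  nonempty : Nonempty X
  compactSpace : CompactSpace X
  totallyDisconnectedSpace : TotallyDisconnectedSpace X
  not_isOpen_singleton : ∀ x : X, ¬ IsOpen {x}
  countingIsHaar : 𝒢.CountingIsHaar

/-- Every isotropy group is trivial. -/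
def IsPrincipal : Prop :=
  ∀ g, 𝒢.r g = 𝒢.s g → g = 𝒢.unit (𝒢.s g)

/-- A `G`-set: a set of arrows on which both the range and the source map are injective. -/
def IsGSet (S : Set G) : Prop :=
  Set.InjOn 𝒢.r S ∧ Set.InjOn 𝒢.s S

/-- A thin subset of the unit space. -/
def IsThin (K : Set X) : Prop :=
  IsCompact K ∧ ∀ n : ℕ, ∃ S : Fin n → Set G,
    (∀ k, IsCompact (S k) ∧ 𝒢.IsGSet (S k) ∧ 𝒢.s '' S k = K) ∧
    Pairwise fun k l => Disjoint (𝒢.r '' S k) (𝒢.r '' S l)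

/-- Invariance of a Borel measure on the unit space. -/
def IsInvariant [MeasurableSpace X] (μ : Measure X) : Prop :=
  ∀ f : C_c(G, ℂ),
    ∫ x, (∑' g : {g : G // 𝒢.r g = x}, f g) ∂μ = ∫ x, (∑' g : {g : G // 𝒢.s g = x}, f g) ∂μ

/-- A subgroupoid containing the entire unit space. -/
structure WideSubgroupoid where
  /-- the set of arrows of the subgroupoid -/
  carrier : Set G
  unit_mem : ∀ x, 𝒢.unit x ∈ carrier
  inv_mem : ∀ g ∈ carrier, 𝒢.inv g ∈ carrier
  mul_mem : ∀ g ∈ carrier, ∀ h ∈ carrier, ∀ e : 𝒢.s g = 𝒢.r h, 𝒢.mul g h e ∈ carrier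

variable {𝒢}

/-- A subgroupoid containing the unit space, as a groupoid in its own right (with the subspace
topology and with the same unit space). -/
def WideSubgroupoid.toGroupoid (H : 𝒢.WideSubgroupoid) : RDiscreteGroupoid X H.carrier where
  r g := 𝒢.r g
  s g := 𝒢.s g
  unit x := ⟨𝒢.unit x, H.unit_mem x⟩
  inv g := ⟨𝒢.inv g, H.inv_mem g g.2⟩
  mul g h e := ⟨𝒢.mul g h e, H.mul_mem g g.2 h h.2 e⟩
  r_unit := 𝒢.r_unit
  s_unit := 𝒢.s_unit
  r_inv g := 𝒢.r_inv g
  s_inv g := 𝒢.s_inv g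
  r_mul g h e := 𝒢.r_mul g h e
  s_mul g h e := 𝒢.s_mul g h e
  unit_mul g := Subtype.ext (𝒢.unit_mul g)
  mul_unit g := Subtype.ext (𝒢.mul_unit g)
  inv_mul g := Subtype.ext (𝒢.inv_mul g)
  mul_inv g := Subtype.ext (𝒢.mul_inv g)
  mul_assoc g h k e₁ e₂ := Subtype.ext (𝒢.mul_assoc g h k e₁ e₂)
  continuous_r := 𝒢.continuous_r.comp continuous_subtype_val
  continuous_s := 𝒢.continuous_s.comp continuous_subtype_val
  continuous_unit := 𝒢.continuous_unit.subtype_mk _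
  continuous_inv := (𝒢.continuous_inv.comp continuous_subtype_val).subtype_mk _
  continuous_mul := by
    refine Continuous.subtype_mk ?_ _
    have h : Continuous fun p : {p : H.carrier × H.carrier // 𝒢.s p.1 = 𝒢.r p.2} =>
        (⟨(p.1.1, p.1.2), p.2⟩ : {p : G × G // 𝒢.s p.1 = 𝒢.r p.2}) := by
      refine Continuous.subtype_mk ?_ _
      fun_prop
    exact 𝒢.continuous_mul.comp h
  isOpen_range_unit := by
    have h : Set.range (fun x => (⟨𝒢.unit x, H.unit_mem x⟩ : H.carrier)) =
        Subtype.val ⁻¹' Set.range 𝒢.unit := by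
      ext g
      simp [Subtype.ext_iff]
    rw [h]
    exact 𝒢.isOpen_range_unit.preimage continuous_subtype_val

variable (𝒢)

/-- AF (approximately finite) Cantor groupoids: increasing unions of sequences of compact open
principal Cantor subgroupoids containing the unit space. -/
def IsAF : Prop :=
  𝒢.IsCantor ∧ ∃ H : ℕ → 𝒢.WideSubgroupoid,
    (∀ n, IsCompact (H n).carrier ∧ IsOpen (H n).carrier ∧
      (H n).toGroupoid.IsCantor ∧ (H n).toGroupoid.IsPrincipal) ∧
    (∀ n, (H n).carrier ⊆ (H (n + 1)).carrier) ∧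
    ⋃ n, (H n).carrier = Set.univ

/-! ### The regular representation -/

/-- The element `g h⁻¹`, for `g` and `h` with the same source. -/
def div (g h : G) (e : 𝒢.s g = 𝒢.s h) : G :=
  𝒢.mul g (𝒢.inv h) (e.trans (𝒢.r_inv h).symm)

open Classical in
/-- The matrix of the regular representation: `f (g h⁻¹)` if `g` and `h` have the same source, and
`0` otherwise. -/
noncomputable def kernel (f : G → ℂ) (g h : G) : ℂ :=
  if e : 𝒢.s g = 𝒢.s h then f (𝒢.div g h e) else 0

lemma mul_congr {g g' h h' : G} (e : 𝒢.s g = 𝒢.r h) (e' : 𝒢.s g' = 𝒢.r h') (hg : g = g')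
    (hh : h = h') : 𝒢.mul g h e = 𝒢.mul g' h' e' := by
  subst hg hh; rfl

lemma mul_left_cancel {g h k : G} (e : 𝒢.s g = 𝒢.r h) (e' : 𝒢.s g = 𝒢.r k)
    (H : 𝒢.mul g h e = 𝒢.mul g k e') : h = k := by
  have key : ∀ l (e : 𝒢.s g = 𝒢.r l), 𝒢.mul (𝒢.inv g) (𝒢.mul g l e)
      ((𝒢.s_inv g).trans (𝒢.r_mul g l e).symm) = l := by
    intro l e
    rw [← 𝒢.mul_assoc _ _ _ (𝒢.s_inv g) e]
    refine Eq.trans ?_ (𝒢.unit_mul l)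
    exact 𝒢.mul_congr _ _ ((𝒢.inv_mul g).trans (by rw [e])) rfl
  rw [← key h e, ← key k e']
  exact 𝒢.mul_congr _ _ rfl H

lemma mul_right_cancel {g h k : G} (e : 𝒢.s g = 𝒢.r k) (e' : 𝒢.s h = 𝒢.r k)
    (H : 𝒢.mul g k e = 𝒢.mul h k e') : g = h := by
  have key : ∀ l (e : 𝒢.s l = 𝒢.r k), 𝒢.mul (𝒢.mul l k e) (𝒢.inv k)
      ((𝒢.s_mul l k e).trans (𝒢.r_inv k).symm) = l := by
    intro l e
    rw [𝒢.mul_assoc _ _ _ e (𝒢.r_inv k).symm]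
    refine Eq.trans ?_ (𝒢.mul_unit l)
    exact 𝒢.mul_congr _ _ rfl ((𝒢.mul_inv k).trans (by rw [e]))
  rw [← key g e, ← key h e']
  exact 𝒢.mul_congr _ _ H rfl

lemma inv_inv (g : G) : 𝒢.inv (𝒢.inv g) = g := by
  have h1 : 𝒢.mul (𝒢.inv g) (𝒢.inv (𝒢.inv g)) (𝒢.r_inv _).symm = 𝒢.unit (𝒢.s g) := by
    rw [𝒢.mul_inv, 𝒢.r_inv]
  exact 𝒢.mul_left_cancel _ (𝒢.s_inv g) (h1.trans (𝒢.inv_mul g).symm)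

lemma exists_open_injOn_r (g : G) : ∃ V : Set G, IsOpen V ∧ g ∈ V ∧ Set.InjOn 𝒢.r V := by
  have hc : Continuous fun p : {p : G × G // 𝒢.r p.1 = 𝒢.r p.2} =>
      𝒢.mul (𝒢.inv p.1.1) p.1.2 ((𝒢.s_inv _).trans p.2) := by
    have h : Continuous fun p : {p : G × G // 𝒢.r p.1 = 𝒢.r p.2} =>
        (⟨(𝒢.inv p.1.1, p.1.2), (𝒢.s_inv _).trans p.2⟩ :
          {p : G × G // 𝒢.s p.1 = 𝒢.r p.2}) := by
      refine Continuous.subtype_mk ?_ _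
      exact (𝒢.continuous_inv.comp (continuous_fst.comp continuous_subtype_val)).prodMk
        (continuous_snd.comp continuous_subtype_val)
    exact 𝒢.continuous_mul.comp h
  obtain ⟨W, hW, hWeq⟩ := isOpen_induced_iff.1 (𝒢.isOpen_range_unit.preimage hc)
  have hgW : (g, g) ∈ W := by
    have : (⟨(g, g), rfl⟩ : {p : G × G // 𝒢.r p.1 = 𝒢.r p.2}) ∈ Subtype.val ⁻¹' W := by
      rw [hWeq]
      exact ⟨𝒢.s g, (𝒢.inv_mul g).symm⟩
    exact this
  obtain ⟨U, V, hU, hV, hgU, hgV, hUV⟩ := isOpen_prod_iff.1 hW g g hgW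
  refine ⟨U ∩ V, hU.inter hV, ⟨hgU, hgV⟩, ?_⟩
  rintro a ⟨haU, -⟩ b ⟨-, hbV⟩ hab
  have hmem : (⟨(a, b), hab⟩ : {p : G × G // 𝒢.r p.1 = 𝒢.r p.2}) ∈ Subtype.val ⁻¹' W :=
    hUV ⟨haU, hbV⟩
  rw [hWeq] at hmem
  obtain ⟨y, hy⟩ := hmem
  simp only at hy
  have hya : y = 𝒢.s a := by
    have := congrArg 𝒢.r hy
    rw [𝒢.r_unit, 𝒢.r_mul, 𝒢.r_inv] at this
    exact this
  subst hya
  exact 𝒢.mul_left_cancel (𝒢.s_inv a) ((𝒢.s_inv a).trans hab) ((𝒢.inv_mul a).trans hy)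

lemma exists_card_r_le {K : Set G} (hK : IsCompact K) :
    ∃ N : ℕ, ∀ x, {g | g ∈ K ∧ 𝒢.r g = x}.encard ≤ N := by
  classical
  choose V hVo hgV hVi using 𝒢.exists_open_injOn_r
  obtain ⟨t, ht⟩ := hK.elim_finite_subcover V hVo
    (fun g _ => Set.mem_iUnion.2 ⟨g, hgV g⟩)
  refine ⟨t.card, fun x => ?_⟩
  have hex : ∀ g ∈ {g | g ∈ K ∧ 𝒢.r g = x}, ∃ i ∈ t, g ∈ V i := by
    intro g hg
    simpa using ht hg.1
  choose! φ hφ hφV using hex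
  have hinj : Set.InjOn φ {g | g ∈ K ∧ 𝒢.r g = x} := by
    intro a ha b hb hab
    exact hVi (φ a) (hφV a ha) (hab ▸ hφV b hb) (ha.2.trans hb.2.symm)
  calc _ ≤ (t : Set G).encard := Set.encard_le_encard_of_injOn (fun g hg => hφ g hg) hinj
    _ = t.card := Set.encard_coe_eq_coe_finsetCard t

lemma exists_card_kernel_le (f : C_c(G, ℂ)) : ∃ N : ℕ,
    (∀ g, {h | 𝒢.kernel f g h ≠ 0}.encard ≤ N) ∧ ∀ h, {g | 𝒢.kernel f g h ≠ 0}.encard ≤ N := by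
  have hK : IsCompact (tsupport f) := f.hasCompactSupport
  obtain ⟨N₁, h₁⟩ := 𝒢.exists_card_r_le hK
  obtain ⟨N₂, h₂⟩ := 𝒢.exists_card_r_le (hK.image 𝒢.continuous_inv)
  classical
  refine ⟨max N₁ N₂, fun g => ?_, fun h => ?_⟩
  · let φ : G → G := fun h => if e : 𝒢.s g = 𝒢.s h then 𝒢.div g h e else g
    have hmem : ∀ h, 𝒢.kernel f g h ≠ 0 → ∃ e : 𝒢.s g = 𝒢.s h, f (𝒢.div g h e) ≠ 0 := by
      intro h hh
      by_cases e : 𝒢.s g = 𝒢.s h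
      · exact ⟨e, by simpa [kernel, e] using hh⟩
      · simp [kernel, e] at hh
    refine (Set.encard_le_encard_of_injOn (f := φ) (t := {k | k ∈ tsupport f ∧ 𝒢.r k = 𝒢.r g})
      ?_ ?_).trans ((h₁ _).trans (by exact_mod_cast le_max_left _ _))
    · intro h hh
      obtain ⟨e, he⟩ := hmem h hh
      simp only [φ, dif_pos e]
      exact ⟨subset_tsupport _ he, 𝒢.r_mul _ _ _⟩
    · intro a ha b hb hab
      obtain ⟨ea, -⟩ := hmem a ha
      obtain ⟨eb, -⟩ := hmem b hb
      simp only [φ, dif_pos ea, dif_pos eb] at hab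
      rw [← 𝒢.inv_inv a, ← 𝒢.inv_inv b, 𝒢.mul_left_cancel _ _ hab]
  · let φ : G → G := fun g => if e : 𝒢.s g = 𝒢.s h then 𝒢.inv (𝒢.div g h e) else g
    have hmem : ∀ g, 𝒢.kernel f g h ≠ 0 → ∃ e : 𝒢.s g = 𝒢.s h, f (𝒢.div g h e) ≠ 0 := by
      intro g hh
      by_cases e : 𝒢.s g = 𝒢.s h
      · exact ⟨e, by simpa [kernel, e] using hh⟩
      · simp [kernel, e] at hh
    refine (Set.encard_le_encard_of_injOn (f := φ)
      (t := {k | k ∈ 𝒢.inv '' tsupport f ∧ 𝒢.r k = 𝒢.r h})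
      ?_ ?_).trans ((h₂ _).trans (by exact_mod_cast le_max_right _ _))
    · intro g hg
      obtain ⟨e, he⟩ := hmem g hg
      simp only [φ, dif_pos e]
      refine ⟨⟨_, subset_tsupport _ he, rfl⟩, ?_⟩
      rw [𝒢.r_inv, div, 𝒢.s_mul, 𝒢.s_inv]
    · intro a ha b hb hab
      obtain ⟨ea, -⟩ := hmem a ha
      obtain ⟨eb, -⟩ := hmem b hb
      simp only [φ, dif_pos ea, dif_pos eb] at hab
      have := congrArg 𝒢.inv hab
      rw [𝒢.inv_inv, 𝒢.inv_inv] at this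
      exact 𝒢.mul_right_cancel _ _ this

lemma exists_norm_kernel_le (f : C_c(G, ℂ)) : ∃ C : ℝ, 0 ≤ C ∧ ∀ g h, ‖𝒢.kernel f g h‖ ≤ C := by
  obtain ⟨C, hC⟩ := f.hasCompactSupport.exists_bound_of_continuous f.continuous
  refine ⟨max C 0, le_max_right _ _, fun g h => ?_⟩
  unfold kernel
  split_ifs with e
  · exact (hC _).trans (le_max_left _ _)
  · simp

end RDiscreteGroupoid

/-- Schur test: an infinite matrix with bounded entries and a bounded number of nonzero entries in
each row and column is bounded on `ℓ²`. -/
lemma sum_norm_sq_matrix_le {ι : Type*} (k : ι → ι → ℂ) {N : ℕ} {C : ℝ}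
    (hk : ∀ i j, ‖k i j‖ ≤ C) (hrow : ∀ i, {j | k i j ≠ 0}.encard ≤ N)
    (hcol : ∀ j, {i | k i j ≠ 0}.encard ≤ N) (ξ : lp (fun _ : ι => ℂ) 2) (F : Finset ι) :
    ∑ i ∈ F, ‖∑' j, k i j * ξ j‖ ^ 2 ≤ (C * N * ‖ξ‖) ^ 2 := by
  classical
  have hfin : ∀ i, {j | k i j ≠ 0}.Finite := fun i =>
    Set.finite_of_encard_le_coe (hrow i)
  let S : ι → Finset ι := fun i => (hfin i).toFinset
  have hS : ∀ i, (S i).card ≤ N := fun i => by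
    have := hrow i
    rw [(hfin i).encard_eq_coe_toFinset_card] at this
    exact_mod_cast this
  have h1 : ∀ i, ‖∑' j, k i j * ξ j‖ ^ 2 ≤ C ^ 2 * N * ∑ j ∈ S i, ‖ξ j‖ ^ 2 := by
    intro i
    have e : ∑' j, k i j * ξ j = ∑ j ∈ S i, k i j * ξ j := by
      refine tsum_eq_sum fun j hj => ?_
      have : k i j = 0 := by simpa [S] using hj
      rw [this, zero_mul]
    rw [e]
    have h2 : ‖∑ j ∈ S i, k i j * ξ j‖ ≤ ∑ j ∈ S i, C * ‖ξ j‖ := by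
      refine (norm_sum_le _ _).trans (Finset.sum_le_sum fun j _ => ?_)
      rw [norm_mul]
      gcongr
      exact hk i j
    calc ‖∑ j ∈ S i, k i j * ξ j‖ ^ 2 ≤ (∑ j ∈ S i, C * ‖ξ j‖) ^ 2 := by gcongr
      _ ≤ (S i).card * ∑ j ∈ S i, (C * ‖ξ j‖) ^ 2 := sq_sum_le_card_mul_sum_sq
      _ ≤ N * ∑ j ∈ S i, (C * ‖ξ j‖) ^ 2 := by
        have := hS i
        gcongr
      _ = C ^ 2 * N * ∑ j ∈ S i, ‖ξ j‖ ^ 2 := by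
        simp_rw [mul_pow, ← Finset.mul_sum]; ring
  have h3 : ∑ i ∈ F, ∑ j ∈ S i, ‖ξ j‖ ^ 2 ≤ N * ‖ξ‖ ^ 2 := by
    have e : ∑ i ∈ F, ∑ j ∈ S i, ‖ξ j‖ ^ 2
        = ∑ j ∈ F.biUnion S, ∑ i ∈ F with k i j ≠ 0, ‖ξ j‖ ^ 2 := by
      refine Finset.sum_comm' fun i j => ?_
      simp only [Finset.mem_biUnion, Finset.mem_filter, S, Set.Finite.mem_toFinset,
        Set.mem_ofPred_eq]
      constructor
      · rintro ⟨hi, hj⟩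
        exact ⟨⟨hi, hj⟩, i, hi, hj⟩
      · rintro ⟨h, -⟩
        exact h
    rw [e]
    have h4 : ∀ j, ∑ i ∈ F with k i j ≠ 0, ‖ξ j‖ ^ 2 ≤ N * ‖ξ j‖ ^ 2 := by
      intro j
      rw [Finset.sum_const, nsmul_eq_mul]
      have : (F.filter fun i => k i j ≠ 0).card ≤ N := by
        have h5 : ((F.filter fun i => k i j ≠ 0 : Finset ι) : Set ι).encard ≤ N :=
          (Set.encard_le_encard (fun i hi => by simpa using (Finset.mem_filter.1 hi).2)).trans
            (hcol j)
        rw [Set.encard_coe_eq_coe_finsetCard] at h5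
        exact_mod_cast h5
      gcongr
    refine (Finset.sum_le_sum fun j _ => h4 j).trans ?_
    rw [← Finset.mul_sum]
    have h6 := lp.sum_rpow_le_norm_rpow (p := 2) (by norm_num) ξ (F.biUnion S)
    simp only [ENNReal.toReal_ofNat, Real.rpow_ofNat] at h6
    gcongr
  calc ∑ i ∈ F, ‖∑' j, k i j * ξ j‖ ^ 2
      ≤ ∑ i ∈ F, C ^ 2 * N * ∑ j ∈ S i, ‖ξ j‖ ^ 2 := Finset.sum_le_sum fun i _ => h1 i
    _ = C ^ 2 * N * ∑ i ∈ F, ∑ j ∈ S i, ‖ξ j‖ ^ 2 := by rw [Finset.mul_sum]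
    _ ≤ C ^ 2 * N * (N * ‖ξ‖ ^ 2) := by gcongr
    _ = (C * N * ‖ξ‖) ^ 2 := by ring

namespace RDiscreteGroupoid

variable {X G : Type*} [TopologicalSpace X] [TopologicalSpace G] (𝒢 : RDiscreteGroupoid X G)

lemma memℓp_kernel (f : C_c(G, ℂ)) (ξ : ℓ²(G, ℂ)) :
    Memℓp (fun g => ∑' h, 𝒢.kernel f g h * ξ h) 2 := by
  obtain ⟨N, hr, hc⟩ := 𝒢.exists_card_kernel_le f
  obtain ⟨C, hC, hk⟩ := 𝒢.exists_norm_kernel_le f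
  refine memℓp_gen' (C := (C * N * ‖ξ‖) ^ 2) fun F => ?_
  simpa using sum_norm_sq_matrix_le _ hk hr hc ξ F

lemma summable_kernel (f : C_c(G, ℂ)) (ξ : ℓ²(G, ℂ)) (g : G) :
    Summable fun h => 𝒢.kernel f g h * ξ h := by
  obtain ⟨N, hr, -⟩ := 𝒢.exists_card_kernel_le f
  refine summable_of_hasFiniteSupport ((Set.finite_of_encard_le_coe (hr g)).subset ?_)
  intro h hh hk
  simp [hk] at hh

/-- The direct sum `λ = ⨁ₓ λₓ` over all units `x` of the regular representations `λₓ` on `ℓ²(Gₓ)`,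
`Gₓ = s⁻¹(x)`, realized on `ℓ²(G) = ⨁ₓ ℓ²(Gₓ)`:
`(λ(f) ξ)(g) = ∑_{h : s(h) = s(g)} f(g h⁻¹) ξ(h)`. -/
noncomputable def regRep (f : C_c(G, ℂ)) : ℓ²(G, ℂ) →L[ℂ] ℓ²(G, ℂ) :=
  LinearMap.mkContinuousOfExistsBound
    { toFun := fun ξ => ⟨fun g => ∑' h, 𝒢.kernel f g h * ξ h, 𝒢.memℓp_kernel f ξ⟩
      map_add' := fun ξ η => by
        ext g
        simp only [lp.coeFn_add, Pi.add_apply, mul_add]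
        exact (𝒢.summable_kernel f ξ g).tsum_add (𝒢.summable_kernel f η g)
      map_smul' := fun c ξ => by
        ext g
        simp only [lp.coeFn_smul, Pi.smul_apply, smul_eq_mul, RingHom.id_apply, mul_left_comm]
        exact tsum_mul_left }
    (by
      obtain ⟨N, hr, hc⟩ := 𝒢.exists_card_kernel_le f
      obtain ⟨C, hC, hk⟩ := 𝒢.exists_norm_kernel_le f
      refine ⟨C * N, fun ξ => ?_⟩
      refine lp.norm_le_of_forall_sum_le (by norm_num) (by positivity) fun F => ?_
      simpa using sum_norm_sq_matrix_le _ hk hr hc ξ F)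

lemma kernel_of_eq (f : G → ℂ) {g h : G} (e : 𝒢.s g = 𝒢.s h) :
    𝒢.kernel f g h = f (𝒢.div g h e) :=
  dif_pos e

lemma kernel_of_ne (f : G → ℂ) {g h : G} (e : 𝒢.s g ≠ 𝒢.s h) : 𝒢.kernel f g h = 0 :=
  dif_neg e

lemma regRep_apply (f : C_c(G, ℂ)) (ξ : ℓ²(G, ℂ)) (g : G) :
    𝒢.regRep f ξ g = ∑' h : {h : G // 𝒢.s g = 𝒢.s h}, f (𝒢.div g h h.2) * ξ h := by
  have h1 : 𝒢.regRep f ξ g = ∑' h, 𝒢.kernel f g h * ξ h := rfl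
  rw [h1]
  have h2 : Function.support (fun h => 𝒢.kernel f g h * ξ h) ⊆ {h | 𝒢.s g = 𝒢.s h} := by
    intro h hh
    by_contra hne
    exact hh (mul_eq_zero_of_left (𝒢.kernel_of_ne f hne) _)
  rw [← tsum_subtype_eq_of_support_subset h2]
  exact tsum_congr fun h => by rw [𝒢.kernel_of_eq f h.2]

/-- The reduced C*-algebra of a groupoid with compact unit space: the C*-algebra generated by the
operators `λ(f)`, `f ∈ C_c(G)`. These operators already form a *-algebra, namely the image of the
convolution algebra `C_c(G)` (whose unit is the characteristic function of the unit space), so this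
is the completion of `C_c(G)` in the norm `‖λ(f)‖ = supₓ ‖λₓ(f)‖`. -/
noncomputable def reducedCStar : StarSubalgebra ℂ (ℓ²(G, ℂ) →L[ℂ] ℓ²(G, ℂ)) :=
  (StarAlgebra.adjoin ℂ (Set.range 𝒢.regRep)).topologicalClosure

/-- The canonical map from `C_c(G)` to the reduced C*-algebra. -/
noncomputable def toReduced (f : C_c(G, ℂ)) : 𝒢.reducedCStar :=
  ⟨𝒢.regRep f, StarSubalgebra.le_topologicalClosure _
    (StarAlgebra.subset_adjoin ℂ _ (Set.mem_range_self f))⟩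

/-- The inclusion `C_c(H) ⊆ C_c(G)` for an open subgroupoid `H` of a Hausdorff groupoid `G`:
extension by zero. -/
noncomputable def WideSubgroupoid.extendZero {𝒢 : RDiscreteGroupoid X G} (H : 𝒢.WideSubgroupoid)
    (hG : T2Space G) (hH : IsOpen H.carrier) (f : C_c(H.carrier, ℂ)) : C_c(G, ℂ) where
  toFun := Function.extend Subtype.val f 0
  continuous_toFun := f.hasCompactSupport.continuous_extend_zero hH f.continuous
  hasCompactSupport' := f.hasCompactSupport.extend_zero continuous_subtype_val

/-- The `G`-invariant Borel probability measures on the unit space. -/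
def InvariantProbability [MeasurableSpace X] : Type _ :=
  {μ : ProbabilityMeasure X // 𝒢.IsInvariant (μ : Measure X)}

end RDiscreteGroupoid

/-- Normalized traces on a unital C*-algebra. -/
structure IsNormalizedTrace {A : Type*} [Ring A] [StarRing A] [Algebra ℂ A] (τ : A →ₗ[ℂ] ℂ) :
    Prop where
  nonneg : ∀ a, 0 ≤ τ (star a * a)
  map_mul_comm : ∀ a b, τ (a * b) = τ (b * a)
  map_one : τ 1 = 1

/-- The space of normalized traces on a unital C*-algebra. -/
def NormalizedTrace (A : Type*) [Ring A] [StarRing A] [Algebra ℂ A] : Type _ :=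
  {τ : A →ₗ[ℂ] ℂ // IsNormalizedTrace τ}

/-!
Let `H` be the open AF subgroupoid of the Cantor groupoid `G`, with unit space `X`.

**Invariant measures.** Invariance under `G` restricts to `H` through extension by zero. Conversely,
an `H`-invariant measure satisfies `μ(r(S)) = μ(s(S))` for compact `H`-sets `S`
(`IsCantor.measure_range_eq`), so that a thin set is null: it has arbitrarily many disjoint
translates of the same measure. Hence the arrows outside of `H` in the support of a function in
`C_c(G)` lie over null sets, and the remaining part of the function is a bounded limit of functions
in `C_c(H)` (`isInvariant_of_toGroupoid`).

**Measures and traces.** The range and source maps are local homeomorphisms, so `C_c(G)` is closed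
under convolution and the operators `λ(f)` are dense in the reduced C*-algebra
(`IsCantor.coe_reducedCStar`). Integrating the diagonal entries `⟨δₓ, a δₓ⟩` over the units `x`
gives a positive functional whose restriction to `C_c(G)` is `f ↦ ∫ f|_X dμ`; it is a trace exactly
if `μ` is invariant, since `(f * g)(x) = ∑_{s(h) = x} f(h⁻¹) g(h)`. By the Riesz representation
theorem every trace is given by a probability measure on `C(X)`; what has to be shown is that the
trace of `f` only depends on `f|_X`. For principal groupoids, this holds because an arrow which is
not a unit starts in a clopen set `A` and ends outside of it, and `τ(f 1_A) = τ(1_A f) = 0` if `f`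
is supported on such arrows (`IsCantor.measureToTrace_surjective_of_principal`). For `G`, one
multiplies `f` by the characteristic function of the complement of a clopen set `Y` of small measure
containing the null set of sources of the arrows outside of `H` in the support of `f`: the result is
in `C_c(H)`, where the trace is known, and the error is small by the Cauchy–Schwarz inequality
`|τ(f 1_Y)|² ≤ τ(f f*) μ(Y)` (`IsCantor.eq_of_eq_extendZero`).

**The inclusion of C*-algebras.** The space `ℓ²(G)` is the direct sum of the spaces `ℓ²(H c)` over
the cosets `H c`, and `λ(f)`, for `f ∈ C_c(H)`, acts on `ℓ²(H c)` as the regular representation of `H`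
acts on the functions on the arrows of `H` which start at `r(c)`. This gives the norm estimate by
which `λ_H(f) ↦ λ(f)` extends to the reduced C*-algebra of `H`
(`WideSubgroupoid.Intertwines.norm_le`).
-/

/-! ### Matrix entries of operators on `ℓ²` -/

section MatrixEntries

variable {ι : Type*}

open Classical in
/-- The standard basis vector of `ℓ²(ι)` at `i`. -/
noncomputable def deltaVec (i : ι) : ℓ²(ι, ℂ) := lp.single 2 i 1

open Classical in
lemma deltaVec_apply (i j : ι) : deltaVec i j = if j = i then 1 else 0 := by
  rw [deltaVec, lp.single_apply, Pi.single_apply]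

lemma inner_deltaVec_left (i : ι) (ξ : ℓ²(ι, ℂ)) : inner ℂ (deltaVec i) ξ = ξ i := by
  classical
  rw [deltaVec, lp.inner_single_left]
  simp

lemma inner_deltaVec_right (i : ι) (ξ : ℓ²(ι, ℂ)) :
    inner ℂ ξ (deltaVec i) = star (ξ i) := by
  rw [← inner_conj_symm, inner_deltaVec_left]
  rfl

lemma norm_deltaVec (i : ι) : ‖(deltaVec i : ℓ²(ι, ℂ))‖ = 1 := by
  classical
  rw [deltaVec, lp.norm_single (by norm_num)]
  simp

lemma norm_lp_apply_le (ξ : ℓ²(ι, ℂ)) (i : ι) : ‖ξ i‖ ≤ ‖ξ‖ :=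
  lp.norm_apply_le_norm (by norm_num) ξ i

lemma clm_ext_deltaVec {F : Type*} [NormedAddCommGroup F] [NormedSpace ℂ F]
    {a b : ℓ²(ι, ℂ) →L[ℂ] F} (h : ∀ j, a (deltaVec j) = b (deltaVec j)) : a = b := by
  classical
  ext ξ
  have h0 : HasSum (fun i => lp.single 2 i (ξ i)) ξ :=
    lp.hasSum_single (by norm_num) ξ
  have h1 : ∀ i, lp.single 2 i (ξ i) = ξ i • (deltaVec i : ℓ²(ι, ℂ)) := by
    intro i
    rw [deltaVec, ← lp.single_smul]
    simp
  simp_rw [h1] at h0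
  have ha := a.hasSum h0
  have hb := b.hasSum h0
  refine ha.unique ?_
  convert hb using 2 with i
  simp [h i]

lemma star_apply_deltaVec (a : ℓ²(ι, ℂ) →L[ℂ] ℓ²(ι, ℂ)) (i j : ι) :
    (star a) (deltaVec j) i = star (a (deltaVec i) j) := by
  rw [← inner_deltaVec_left, ContinuousLinearMap.star_eq_adjoint,
    ContinuousLinearMap.adjoint_inner_right, inner_deltaVec_right]

end MatrixEntries

namespace RDiscreteGroupoid

variable {X G : Type*} [TopologicalSpace X] [TopologicalSpace G] (𝒢 : RDiscreteGroupoid X G)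

/-! ### Algebra of arrows -/

lemma r_div (g h : G) (e : 𝒢.s g = 𝒢.s h) : 𝒢.r (𝒢.div g h e) = 𝒢.r g := 𝒢.r_mul _ _ _

lemma s_div (g h : G) (e : 𝒢.s g = 𝒢.s h) : 𝒢.s (𝒢.div g h e) = 𝒢.r h := by
  rw [div, 𝒢.s_mul, 𝒢.s_inv]

lemma div_mul_cancel (g h : G) (e : 𝒢.s g = 𝒢.s h) :
    𝒢.mul (𝒢.div g h e) h (𝒢.s_div g h e) = g := by
  unfold div
  rw [𝒢.mul_assoc _ _ _ _ (𝒢.s_inv h)]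
  exact (𝒢.mul_congr _ (𝒢.r_unit _).symm rfl ((𝒢.inv_mul h).trans (by rw [e]))).trans
    (𝒢.mul_unit g)

lemma mul_div_cancel (g h : G) (e : 𝒢.s g = 𝒢.r h) :
    𝒢.div (𝒢.mul g h e) h (𝒢.s_mul g h e) = g := by
  unfold div
  rw [𝒢.mul_assoc _ _ _ e (𝒢.r_inv h).symm]
  exact (𝒢.mul_congr _ (𝒢.r_unit _).symm rfl ((𝒢.mul_inv h).trans (by rw [e]))).trans
    (𝒢.mul_unit g)

lemma div_self (g : G) : 𝒢.div g g rfl = 𝒢.unit (𝒢.r g) := 𝒢.mul_inv g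

lemma div_congr {g g' h h' : G} (e : 𝒢.s g = 𝒢.s h) (e' : 𝒢.s g' = 𝒢.s h') (hg : g = g')
    (hh : h = h') : 𝒢.div g h e = 𝒢.div g' h' e' := by
  subst hg hh; rfl

/-- An arrow `k` with `k h = g` is `g h⁻¹`. -/
lemma eq_div_of_mul_eq {g h k : G} (e : 𝒢.s g = 𝒢.s h) (e' : 𝒢.s k = 𝒢.r h)
    (H : 𝒢.mul k h e' = g) : 𝒢.div g h e = k :=
  𝒢.mul_right_cancel (𝒢.s_div g h e) e' ((𝒢.div_mul_cancel g h e).trans H.symm)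

lemma inv_unit (x : X) : 𝒢.inv (𝒢.unit x) = 𝒢.unit x := by
  have e : 𝒢.s (𝒢.unit x) = 𝒢.r (𝒢.unit x) := by rw [𝒢.s_unit, 𝒢.r_unit]
  refine 𝒢.mul_left_cancel (𝒢.r_inv _).symm e ?_
  rw [𝒢.mul_inv, 𝒢.r_unit]
  refine ((𝒢.mul_congr _ (𝒢.r_unit _).symm rfl ?_).trans (𝒢.mul_unit (𝒢.unit x))).symm
  rw [𝒢.s_unit]

lemma div_unit (g : G) {x : X} (e : 𝒢.s g = 𝒢.s (𝒢.unit x)) : 𝒢.div g (𝒢.unit x) e = g := by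
  have hx : 𝒢.s g = x := e.trans (𝒢.s_unit x)
  refine 𝒢.eq_div_of_mul_eq e (hx.trans (𝒢.r_unit x).symm) ?_
  exact (𝒢.mul_congr _ (𝒢.r_unit _).symm rfl (by rw [hx])).trans (𝒢.mul_unit g)

lemma unit_div (h : G) {x : X} (e : 𝒢.s (𝒢.unit x) = 𝒢.s h) :
    𝒢.div (𝒢.unit x) h e = 𝒢.inv h := by
  have hx : x = 𝒢.s h := (𝒢.s_unit x).symm.trans e
  refine 𝒢.eq_div_of_mul_eq e (𝒢.s_inv h) ?_
  rw [𝒢.inv_mul, hx]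

lemma inv_div (g h : G) (e : 𝒢.s g = 𝒢.s h) : 𝒢.inv (𝒢.div g h e) = 𝒢.div h g e.symm := by
  refine 𝒢.mul_left_cancel (g := 𝒢.div g h e) (𝒢.r_inv _).symm
    ((𝒢.s_div g h e).trans (𝒢.r_div h g e.symm).symm) ?_
  rw [𝒢.mul_inv, 𝒢.r_div]
  refine 𝒢.mul_right_cancel (k := g) (𝒢.s_unit _)
    ((𝒢.s_mul _ _ _).trans (𝒢.s_div h g e.symm)) ?_
  rw [𝒢.unit_mul, 𝒢.mul_assoc _ _ _ _ (𝒢.s_div h g e.symm)]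
  refine ((𝒢.mul_congr _ (𝒢.s_div g h e) rfl (𝒢.div_mul_cancel h g e.symm)).trans
    (𝒢.div_mul_cancel g h e)).symm

lemma mul_div_mul (g h k : G) (e : 𝒢.s g = 𝒢.s h) (e₁ : 𝒢.s g = 𝒢.r k) (e₂ : 𝒢.s h = 𝒢.r k) :
    𝒢.div (𝒢.mul g k e₁) (𝒢.mul h k e₂) ((𝒢.s_mul _ _ _).trans (𝒢.s_mul _ _ _).symm) =
      𝒢.div g h e := by
  refine 𝒢.eq_div_of_mul_eq _ ((𝒢.s_div _ _ _).trans (𝒢.r_mul _ _ _).symm) ?_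
  rw [← 𝒢.mul_assoc _ _ _ (𝒢.s_div g h e) e₂]
  exact 𝒢.mul_congr _ _ (𝒢.div_mul_cancel g h e) rfl

/-- Right multiplication by `b⁻¹` is a bijection from `s⁻¹(s(b))` onto `s⁻¹(r(b))`. -/
def divRightEquiv (b : G) : {m : G // 𝒢.s m = 𝒢.s b} ≃ {h : G // 𝒢.s h = 𝒢.r b} where
  toFun m := ⟨𝒢.div m b m.2, 𝒢.s_div _ _ _⟩
  invFun h := ⟨𝒢.mul h b h.2, 𝒢.s_mul _ _ _⟩
  left_inv m := Subtype.ext (𝒢.div_mul_cancel m b m.2)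
  right_inv h := Subtype.ext (𝒢.mul_div_cancel h b h.2)

/-- The inverse, as a homeomorphism. -/
def invHomeomorph : G ≃ₜ G where
  toFun := 𝒢.inv
  invFun := 𝒢.inv
  left_inv := 𝒢.inv_inv
  right_inv := 𝒢.inv_inv
  continuous_toFun := 𝒢.continuous_inv
  continuous_invFun := 𝒢.continuous_inv

/-- The inverse exchanges the fibres of the source and range maps. -/
def invFibreEquiv (x : X) : {g : G // 𝒢.s g = x} ≃ {g : G // 𝒢.r g = x} where
  toFun g := ⟨𝒢.inv g, (𝒢.r_inv _).trans g.2⟩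
  invFun g := ⟨𝒢.inv g, (𝒢.s_inv _).trans g.2⟩
  left_inv g := Subtype.ext (𝒢.inv_inv g)
  right_inv g := Subtype.ext (𝒢.inv_inv g)

/-! ### The regular representation: linearity and adjoints -/

lemma regRep_eq_tsum_kernel (f : C_c(G, ℂ)) (ξ : ℓ²(G, ℂ)) (g : G) :
    𝒢.regRep f ξ g = ∑' h, 𝒢.kernel f g h * ξ h := rfl

lemma regRep_deltaVec (f : C_c(G, ℂ)) (g h : G) :
    𝒢.regRep f (deltaVec h) g = 𝒢.kernel f g h := by
  rw [regRep_eq_tsum_kernel, tsum_eq_single h]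
  · simp [deltaVec_apply]
  · intro k hk
    simp [deltaVec_apply, hk]

lemma regRep_add (f g : C_c(G, ℂ)) : 𝒢.regRep (f + g) = 𝒢.regRep f + 𝒢.regRep g := by
  refine clm_ext_deltaVec fun j => lp.ext (funext fun i => ?_)
  simp only [add_apply, lp.coeFn_add, Pi.add_apply, regRep_deltaVec, kernel]
  split_ifs <;> simp

lemma regRep_smul (c : ℂ) (f : C_c(G, ℂ)) : 𝒢.regRep (c • f) = c • 𝒢.regRep f := by
  refine clm_ext_deltaVec fun j => lp.ext (funext fun i => ?_)
  simp only [smul_apply, lp.coeFn_smul, Pi.smul_apply, regRep_deltaVec, kernel]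
  split_ifs <;> simp

/-- The involution `f*(g) = conj f(g⁻¹)` of `C_c(G)`. -/
noncomputable def involution (f : C_c(G, ℂ)) : C_c(G, ℂ) where
  toFun g := star (f (𝒢.inv g))
  continuous_toFun := continuous_star.comp (f.continuous.comp 𝒢.continuous_inv)
  hasCompactSupport' :=
    (f.hasCompactSupport.comp_homeomorph 𝒢.invHomeomorph).comp_left (star_zero ℂ)

lemma involution_apply (f : C_c(G, ℂ)) (g : G) : 𝒢.involution f g = star (f (𝒢.inv g)) := rfl

lemma star_regRep (f : C_c(G, ℂ)) : star (𝒢.regRep f) = 𝒢.regRep (𝒢.involution f) := by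
  refine clm_ext_deltaVec fun j => lp.ext (funext fun i => ?_)
  rw [star_apply_deltaVec, regRep_deltaVec, regRep_deltaVec]
  by_cases e : 𝒢.s i = 𝒢.s j
  · rw [𝒢.kernel_of_eq _ e, 𝒢.kernel_of_eq _ e.symm, involution_apply, 𝒢.inv_div]
  · rw [𝒢.kernel_of_ne _ e, 𝒢.kernel_of_ne _ (Ne.symm e), star_zero]

end RDiscreteGroupoid

namespace RDiscreteGroupoid

variable {X G : Type*} [TopologicalSpace X] [TopologicalSpace G] (𝒢 : RDiscreteGroupoid X G)

/-! ### The range and source maps are local homeomorphisms -/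

variable {𝒢} in
lemma IsCantor.t2Space_unit (hG : 𝒢.IsCantor) : T2Space X := by
  have := hG.t2Space
  exact T2Space.of_injective_continuous
    (Function.LeftInverse.injective 𝒢.r_unit) 𝒢.continuous_unit

variable {𝒢} in
lemma IsCantor.secondCountable_unit (hG : 𝒢.IsCantor) : SecondCountableTopology X := by
  have := hG.secondCountableTopology
  have h : Topology.IsEmbedding 𝒢.unit :=
    .of_leftInverse 𝒢.r_unit 𝒢.continuous_r 𝒢.continuous_unit
  exact h.secondCountableTopology

variable {𝒢} in
lemma IsCantor.isClopen_range_unit (hG : 𝒢.IsCantor) : IsClopen (Set.range 𝒢.unit) := by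
  have := hG.t2Space
  have := hG.compactSpace
  exact ⟨(isCompact_range 𝒢.continuous_unit).isClosed, 𝒢.isOpen_range_unit⟩

lemma finite_support_r (f : C_c(G, ℂ)) (x : X) :
    (Function.support fun g : {g : G // 𝒢.r g = x} => f g).Finite := by
  obtain ⟨N, hN⟩ := 𝒢.exists_card_r_le f.hasCompactSupport
  refine Set.Finite.of_finite_image (f := Subtype.val) ?_ Subtype.val_injective.injOn
  refine (Set.finite_of_encard_le_coe (hN x)).subset ?_
  rintro _ ⟨g, hg, rfl⟩
  exact ⟨subset_tsupport _ hg, g.2⟩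

lemma summable_r (f : C_c(G, ℂ)) (x : X) : Summable fun g : {g : G // 𝒢.r g = x} => f g :=
  summable_of_hasFiniteSupport (𝒢.finite_support_r f x)

/-- The complexification of a real continuous function with compact support. -/
noncomputable def complexify {Y : Type*} [TopologicalSpace Y] (f : C(Y, ℝ))
    (hf : HasCompactSupport f) : C_c(Y, ℂ) where
  toFun y := f y
  continuous_toFun := Complex.continuous_ofReal.comp f.continuous
  hasCompactSupport' := hf.comp_left (g := Complex.ofReal) Complex.ofReal_zero

variable {𝒢} in
/-- The continuity of `x ↦ ∑_{r(g) = x} f(g)` forces the range map to be open: for a bump function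
`f` supported in `V`, the set where this sum does not vanish is an open subset of `r(V)`. -/
lemma IsCantor.isOpenMap_r (hG : 𝒢.IsCantor) : IsOpenMap 𝒢.r := by
  have := hG.t2Space
  have := hG.locallyCompactSpace
  intro V hV
  rw [isOpen_iff_mem_nhds]
  rintro _ ⟨g, hg, rfl⟩
  obtain ⟨f, hf1, hf0, hfc, hf⟩ := exists_continuous_one_zero_of_isCompact
    (isCompact_singleton (x := g)) hV.isClosed_compl (by simpa using hg)
  have hc := hG.countingIsHaar (complexify f hfc)
  refine Filter.mem_of_superset (((isOpen_ne (x := (0 : ℂ))).preimage hc).mem_nhds (x := 𝒢.r g) ?_) ?_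
  · have hs : Summable fun k : {k : G // 𝒢.r k = 𝒢.r g} => f k := by
      have := 𝒢.summable_r (complexify f hfc) (𝒢.r g)
      exact Complex.summable_ofReal.1 this
    have h1 : (1 : ℝ) ≤ ∑' k : {k : G // 𝒢.r k = 𝒢.r g}, f k := by
      have h2 := hs.le_tsum ⟨g, rfl⟩ fun k _ => (hf k).1
      have h3 : f g = 1 := hf1 rfl
      simpa [h3] using h2
    have h4 : ∑' k : {k : G // 𝒢.r k = 𝒢.r g}, (complexify f hfc) k
        = ((∑' k : {k : G // 𝒢.r k = 𝒢.r g}, f k : ℝ) : ℂ) := (Complex.ofReal_tsum _).symm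
    simp only [Set.mem_preimage, Set.mem_ofPred_eq, h4]
    exact_mod_cast (zero_lt_one.trans_le h1).ne'
  · intro x hx
    by_contra hxV
    refine hx ?_
    have h0 : ∀ k : {k : G // 𝒢.r k = x}, complexify f hfc k = 0 := by
      intro k
      have : f k = 0 := hf0 fun hk => hxV ⟨k, hk, k.2⟩
      exact (congrArg Complex.ofReal this).trans Complex.ofReal_zero
    simp [h0]

variable {𝒢} in
lemma IsCantor.isOpenMap_s (hG : 𝒢.IsCantor) : IsOpenMap 𝒢.s := by
  have h : 𝒢.s = 𝒢.r ∘ 𝒢.invHomeomorph := funext fun g => (𝒢.r_inv g).symm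
  rw [h]
  exact hG.isOpenMap_r.comp 𝒢.invHomeomorph.isOpenMap

lemma exists_open_injOn_s (g : G) : ∃ V : Set G, IsOpen V ∧ g ∈ V ∧ Set.InjOn 𝒢.s V := by
  obtain ⟨V, hV, hgV, hi⟩ := 𝒢.exists_open_injOn_r (𝒢.inv g)
  refine ⟨𝒢.inv ⁻¹' V, hV.preimage 𝒢.continuous_inv, hgV, fun a ha b hb hab => ?_⟩
  have := hi ha hb (by rw [𝒢.r_inv, 𝒢.r_inv, hab])
  rw [← 𝒢.inv_inv a, this, 𝒢.inv_inv]

variable {𝒢} in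
/-- A clopen subset of `s(V)` pulls back to a compact open subset of `V` if the source map is
injective on the open set `V`, as it then is a homeomorphism from `V` onto `s(V)`. -/
lemma IsCantor.exists_compact_open_injOn_s (hG : 𝒢.IsCantor) (g : G) :
    ∃ U : Set G, IsCompact U ∧ IsOpen U ∧ g ∈ U ∧ Set.InjOn 𝒢.s U := by
  have := hG.t2Space
  have := hG.compactSpace
  have := hG.t2Space_unit
  have := hG.totallyDisconnectedSpace
  obtain ⟨V, hV, hgV, hi⟩ := 𝒢.exists_open_injOn_s g
  have he : Topology.IsOpenEmbedding (V.domRestrict 𝒢.s) :=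
    .of_continuous_injective_isOpenMap (𝒢.continuous_s.comp continuous_subtype_val)
      (Set.injOn_iff_injective.1 hi) (hG.isOpenMap_s.domRestrict hV)
  obtain ⟨C, hC, hgC, hCV⟩ := compact_exists_isClopen_in_isOpen (hG.isOpenMap_s V hV)
    (Set.mem_image_of_mem 𝒢.s hgV)
  refine ⟨Subtype.val '' (V.domRestrict 𝒢.s ⁻¹' C), ?_, ?_, ⟨⟨g, hgV⟩, hgC, rfl⟩, ?_⟩
  · refine IsCompact.image ?_ continuous_subtype_val
    refine (he.isInducing.isCompact_preimage_iff ?_).2 hC.1.isCompact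
    rwa [Set.range_domRestrict]
  · exact hV.isOpenMap_subtype_val _ (hC.2.preimage he.continuous)
  · refine hi.mono ?_
    rintro _ ⟨k, -, rfl⟩
    exact k.2

/-! ### Functions with compact support on the arrow space -/

/-- The pointwise product of a compactly supported function and a continuous function. -/
noncomputable def mulCont (f : C_c(G, ℂ)) (φ : C(G, ℂ)) : C_c(G, ℂ) where
  toFun g := f g * φ g
  continuous_toFun := f.continuous.mul φ.continuous
  hasCompactSupport' := f.hasCompactSupport.mul_right

lemma mulCont_apply (f : C_c(G, ℂ)) (φ : C(G, ℂ)) (g : G) : mulCont f φ g = f g * φ g := rfl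

/-- The characteristic function of a clopen set. -/
noncomputable def clopenInd {Y : Type*} [TopologicalSpace Y] {A : Set Y} (hA : IsClopen A) :
    C(Y, ℂ) :=
  ⟨A.indicator 1, hA.continuous_indicator continuous_one⟩

lemma clopenInd_of_mem {Y : Type*} [TopologicalSpace Y] {A : Set Y} (hA : IsClopen A) {y : Y}
    (hy : y ∈ A) : clopenInd hA y = 1 := Set.indicator_of_mem hy _

lemma clopenInd_of_notMem {Y : Type*} [TopologicalSpace Y] {A : Set Y} (hA : IsClopen A) {y : Y}
    (hy : y ∉ A) : clopenInd hA y = 0 := Set.indicator_of_notMem hy _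

lemma eq_mulCont_add_mulCont (f : C_c(G, ℂ)) {U : Set G} (hU : IsClopen U) :
    f = mulCont f (clopenInd hU) + mulCont f (clopenInd hU.compl) := by
  ext g
  simp only [CompactlySupportedContinuousMap.add_apply, mulCont_apply]
  by_cases hg : g ∈ U
  · rw [clopenInd_of_mem hU hg, clopenInd_of_notMem hU.compl (by simpa using hg)]
    ring
  · rw [clopenInd_of_notMem hU hg, clopenInd_of_mem hU.compl hg]
    ring

variable {𝒢} in
/-- `C_c(G)` is spanned by functions supported in compact open sets on which the source map is
injective. -/
lemma IsCantor.compactlySupported_induction (hG : 𝒢.IsCantor) {P : C_c(G, ℂ) → Prop}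
    (zero : P 0) (add : ∀ f g, P f → P g → P (f + g))
    (basic : ∀ (U : Set G), IsCompact U → IsOpen U → Set.InjOn 𝒢.s U →
      ∀ f : C_c(G, ℂ), Function.support f ⊆ U → P f) (f : C_c(G, ℂ)) : P f := by
  classical
  have := hG.t2Space
  choose U hUc hUo hgU hUi using hG.exists_compact_open_injOn_s
  obtain ⟨t, ht⟩ := f.hasCompactSupport.elim_finite_subcover U hUo
    (fun g _ => Set.mem_iUnion.2 ⟨g, hgU g⟩)
  have hf : Function.support f ⊆ ⋃ i ∈ t, U i := (subset_tsupport _).trans ht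
  clear ht
  induction t using Finset.induction_on generalizing f with
  | empty =>
    have : f = 0 := by
      ext g
      by_contra hg
      simpa using hf hg
    rwa [this]
  | insert i t _ ih =>
    have hcl : IsClopen (U i) := ⟨(hUc i).isClosed, hUo i⟩
    rw [eq_mulCont_add_mulCont f hcl]
    refine add _ _ (basic (U i) (hUc i) (hUo i) (hUi i) _ ?_) (ih _ ?_)
    · intro g hg
      by_contra h
      exact hg (by rw [mulCont_apply, clopenInd_of_notMem hcl h, mul_zero])
    · intro g hg
      rw [Function.mem_support, mulCont_apply] at hg
      have h1 : g ∉ U i := fun h =>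
        right_ne_zero_of_mul hg (clopenInd_of_notMem hcl.compl (by simpa using h))
      have h2 := hf (left_ne_zero_of_mul hg)
      simp only [Finset.mem_insert, Set.mem_iUnion] at h2 ⊢
      obtain ⟨j, rfl | hj, hgj⟩ := h2
      · exact absurd hgj h1
      · exact ⟨j, hj, hgj⟩

/-! ### Convolution -/

lemma summable_kernel_mul (f g : C_c(G, ℂ)) (k : G) :
    Summable fun h => 𝒢.kernel f k h * g h := by
  obtain ⟨N, hr, -⟩ := 𝒢.exists_card_kernel_le f
  refine summable_of_hasFiniteSupport ((Set.finite_of_encard_le_coe (hr k)).subset ?_)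
  intro h hh hk
  simp [hk] at hh

variable {𝒢} in
/-- The convolution of two functions in `C_c(G)` is in `C_c(G)`. When the second function lives on
a compact open set `U` with a continuous local section `σ` of the source map, the convolution is
`k ↦ f(k σ(s(k))⁻¹) g(σ(s(k)))` over the clopen set `s(U)` and vanishes elsewhere. -/
lemma IsCantor.exists_conv (hG : 𝒢.IsCantor) (f g : C_c(G, ℂ)) :
    ∃ F : C_c(G, ℂ), ∀ k, F k = ∑' h, 𝒢.kernel f k h * g h := by
  classical
  have := hG.t2Space
  have := hG.t2Space_unit
  induction g using hG.compactlySupported_induction with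
  | zero => exact ⟨0, fun k => by simp⟩
  | add g₁ g₂ h₁ h₂ =>
    obtain ⟨F₁, hF₁⟩ := h₁
    obtain ⟨F₂, hF₂⟩ := h₂
    refine ⟨F₁ + F₂, fun k => ?_⟩
    simp only [CompactlySupportedContinuousMap.add_apply, mul_add, hF₁, hF₂]
    exact ((𝒢.summable_kernel_mul f g₁ k).tsum_add (𝒢.summable_kernel_mul f g₂ k)).symm
  | basic U hUc hUo hUi g hg =>
    rcases isEmpty_or_nonempty G with hE | hE
    · exact ⟨0, fun k => (hE.false k).elim⟩
    set σ : X → G := Function.invFunOn 𝒢.s U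
    have hσ : Set.LeftInvOn σ 𝒢.s U := hUi.leftInvOn_invFunOn
    have hσc : ContinuousOn σ (𝒢.s '' U) :=
      (hG.isOpenMap_s.domRestrict hUo).continuousOn_image_of_leftInvOn hσ
    set W : Set G := 𝒢.s ⁻¹' (𝒢.s '' U)
    have hW : IsClopen W := (IsClopen.preimage
      ⟨(hUc.image 𝒢.continuous_s).isClosed, hG.isOpenMap_s U hUo⟩ 𝒢.continuous_s)
    have hσU : ∀ k ∈ W, σ (𝒢.s k) ∈ U ∧ 𝒢.s k = 𝒢.s (σ (𝒢.s k)) := by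
      rintro k ⟨u, hu, huk⟩
      rw [← huk, hσ hu]
      exact ⟨hu, rfl⟩
    set φ : G → ℂ := fun k => 𝒢.kernel f k (σ (𝒢.s k)) * g (σ (𝒢.s k))
    have hφ : ∀ k, ∑' h, 𝒢.kernel f k h * g h = W.indicator φ k := by
      intro k
      by_cases hk : k ∈ W
      · rw [Set.indicator_of_mem hk]
        refine tsum_eq_single _ fun h hh => ?_
        by_contra hne
        have hhU : h ∈ U := hg (right_ne_zero_of_mul hne)
        have e : 𝒢.s k = 𝒢.s h := by
          by_contra e
          exact left_ne_zero_of_mul hne (𝒢.kernel_of_ne f e)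
        exact hh (hUi hhU (hσU k hk).1 (e.symm.trans (hσU k hk).2))
      · rw [Set.indicator_of_notMem hk]
        refine (tsum_congr fun h => ?_).trans tsum_zero
        by_contra hne
        have hhU : h ∈ U := hg (right_ne_zero_of_mul hne)
        have e : 𝒢.s k = 𝒢.s h := by
          by_contra e
          exact left_ne_zero_of_mul hne (𝒢.kernel_of_ne f e)
        exact hk ⟨h, hhU, e.symm⟩
    have hφc : ContinuousOn φ W := by
      rw [continuousOn_iff_continuous_domRestrict]
      have hσW : Continuous fun k : W => σ (𝒢.s k) :=
        hσc.comp_continuous (𝒢.continuous_s.comp continuous_subtype_val) fun k => k.2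
      have h1 : Continuous fun k : W => 𝒢.div k (σ (𝒢.s k)) (hσU k k.2).2 := by
        have h2 : Continuous fun k : W => (⟨(k.1, 𝒢.inv (σ (𝒢.s k))),
            (hσU k k.2).2.trans (𝒢.r_inv _).symm⟩ : {p : G × G // 𝒢.s p.1 = 𝒢.r p.2}) :=
          Continuous.subtype_mk
            (continuous_subtype_val.prodMk (𝒢.continuous_inv.comp hσW)) _
        exact 𝒢.continuous_mul.comp h2
      refine ((f.continuous.comp h1).mul (g.continuous.comp hσW)).congr fun k => ?_
      simp only [Set.domRestrict_apply, φ, 𝒢.kernel_of_eq _ (hσU k k.2).2]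
      rfl
    have hcont : Continuous (W.indicator φ) := by
      rw [← continuousOn_univ, ← Set.union_compl_self W]
      refine ContinuousOn.union_of_isOpen ?_ ?_ hW.2 hW.compl.2
      · exact hφc.congr fun k hk => Set.indicator_of_mem hk _
      · exact continuousOn_const.congr fun k hk => Set.indicator_of_notMem hk _
    refine ⟨⟨⟨W.indicator φ, hcont⟩, ?_⟩, fun k => (hφ k).symm⟩
    have hQ : IsCompact (Subtype.val ⁻¹' (tsupport f ×ˢ U) :
        Set {p : G × G // 𝒢.s p.1 = 𝒢.r p.2}) := by
      have hcl : IsClosed {p : G × G | 𝒢.s p.1 = 𝒢.r p.2} :=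
        isClosed_eq (𝒢.continuous_s.comp continuous_fst) (𝒢.continuous_r.comp continuous_snd)
      exact hcl.isClosedEmbedding_subtypeVal.isCompact_preimage
        (f.hasCompactSupport.isCompact.prod hUc)
    refine HasCompactSupport.intro (hQ.image 𝒢.continuous_mul) fun k hk => ?_
    by_contra hne
    change W.indicator φ k ≠ 0 at hne
    have hkW : k ∈ W := Set.mem_of_indicator_ne_zero hne
    rw [Set.indicator_of_mem hkW] at hne
    have hf := left_ne_zero_of_mul hne
    rw [𝒢.kernel_of_eq _ (hσU k hkW).2] at hf
    exact hk ⟨⟨(𝒢.div k (σ (𝒢.s k)) (hσU k hkW).2, σ (𝒢.s k)), 𝒢.s_div _ _ (hσU k hkW).2⟩,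
      ⟨subset_tsupport _ hf, (hσU k hkW).1⟩, 𝒢.div_mul_cancel _ _ (hσU k hkW).2⟩

/-- `(a b⁻¹)(m b⁻¹)⁻¹ = a m⁻¹`. -/
lemma div_div (a m b : G) (e : 𝒢.s a = 𝒢.s b) (e' : 𝒢.s m = 𝒢.s b) :
    𝒢.div (𝒢.div a b e) (𝒢.div m b e') ((𝒢.s_div a b e).trans (𝒢.s_div m b e').symm) =
      𝒢.div a m (e.trans e'.symm) := by
  rw [← 𝒢.mul_div_mul _ _ b _ (𝒢.s_div a b e) (𝒢.s_div m b e')]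
  exact 𝒢.div_congr _ _ (𝒢.div_mul_cancel a b e) (𝒢.div_mul_cancel m b e')

variable {𝒢} in
lemma IsCantor.exists_regRep_mul (hG : 𝒢.IsCantor) (f g : C_c(G, ℂ)) :
    ∃ F : C_c(G, ℂ), 𝒢.regRep f * 𝒢.regRep g = 𝒢.regRep F := by
  obtain ⟨F, hF⟩ := hG.exists_conv f g
  refine ⟨F, clm_ext_deltaVec fun b => lp.ext (funext fun a => ?_)⟩
  rw [mul_apply_eq_comp, regRep_eq_tsum_kernel, regRep_deltaVec]
  simp only [regRep_deltaVec]
  by_cases e : 𝒢.s a = 𝒢.s b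
  · rw [𝒢.kernel_of_eq _ e, hF]
    have h1 : Function.support (fun m => 𝒢.kernel f a m * 𝒢.kernel g m b) ⊆
        {m | 𝒢.s m = 𝒢.s b} := by
      intro m hm
      by_contra hne
      exact hm (mul_eq_zero_of_right _ (𝒢.kernel_of_ne g hne))
    have h2 : Function.support (fun h => 𝒢.kernel f (𝒢.div a b e) h * g h) ⊆
        {h | 𝒢.s h = 𝒢.r b} := by
      intro h hh
      by_contra hne
      refine hh (mul_eq_zero_of_left (𝒢.kernel_of_ne f ?_) _)
      rw [𝒢.s_div]
      exact Ne.symm hne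
    rw [← tsum_subtype_eq_of_support_subset h1, ← tsum_subtype_eq_of_support_subset h2]
    refine Eq.trans (tsum_congr fun m => ?_) ((𝒢.divRightEquiv b).tsum_eq
      fun h : {h : G // 𝒢.s h = 𝒢.r b} => 𝒢.kernel f (𝒢.div a b e) h * g h)
    have hm : 𝒢.s m = 𝒢.s b := m.2
    change 𝒢.kernel f a m * 𝒢.kernel g m b =
      𝒢.kernel f (𝒢.div a b e) (𝒢.div m b hm) * g (𝒢.div m b hm)
    rw [𝒢.kernel_of_eq g hm, 𝒢.kernel_of_eq f (e.trans hm.symm),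
      𝒢.kernel_of_eq f ((𝒢.s_div a b e).trans (𝒢.s_div m b hm).symm), 𝒢.div_div a m b e hm]
  · rw [𝒢.kernel_of_ne _ e]
    refine (tsum_congr fun m => ?_).trans tsum_zero
    by_cases e' : 𝒢.s a = 𝒢.s m
    · rw [𝒢.kernel_of_ne g (e' ▸ e), mul_zero]
    · rw [𝒢.kernel_of_ne f e', zero_mul]

/-! ### Functions on the unit space and the unit of the reduced C*-algebra -/

variable {𝒢} in
/-- A continuous function on the unit space, extended by zero to the arrow space. -/
noncomputable def IsCantor.diag (hG : 𝒢.IsCantor) (g : C(X, ℂ)) : C_c(G, ℂ) where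
  toFun := (Set.range 𝒢.unit).indicator fun k => g (𝒢.r k)
  continuous_toFun := hG.isClopen_range_unit.continuous_indicator (g.continuous.comp 𝒢.continuous_r)
  hasCompactSupport' := by
    have := hG.t2Space
    have := hG.compactSpace
    exact HasCompactSupport.intro (isCompact_range 𝒢.continuous_unit)
      fun k hk => Set.indicator_of_notMem hk _

variable {𝒢}

lemma IsCantor.diag_unit (hG : 𝒢.IsCantor) (g : C(X, ℂ)) (x : X) :
    hG.diag g (𝒢.unit x) = g x := by
  refine (Set.indicator_of_mem (Set.mem_range_self x) fun k => g (𝒢.r k)).trans ?_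
  rw [𝒢.r_unit]

lemma IsCantor.diag_of_notMem (hG : 𝒢.IsCantor) (g : C(X, ℂ)) {k : G}
    (hk : k ∉ Set.range 𝒢.unit) : hG.diag g k = 0 :=
  Set.indicator_of_notMem hk fun k => g (𝒢.r k)

lemma IsCantor.regRep_diag_apply (hG : 𝒢.IsCantor) (g : C(X, ℂ)) (ξ : ℓ²(G, ℂ)) (k : G) :
    𝒢.regRep (hG.diag g) ξ k = g (𝒢.r k) * ξ k := by
  rw [regRep_eq_tsum_kernel, tsum_eq_single k]
  · rw [𝒢.kernel_of_eq _ rfl, 𝒢.div_self, hG.diag_unit]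
  · intro h hh
    refine mul_eq_zero_of_left ?_ _
    by_cases e : 𝒢.s k = 𝒢.s h
    · rw [𝒢.kernel_of_eq _ e]
      refine hG.diag_of_notMem g ?_
      rintro ⟨x, hx⟩
      refine hh ?_
      have h1 : x = 𝒢.r h := by rw [← 𝒢.s_div k h e, ← hx, 𝒢.s_unit]
      rw [← 𝒢.div_mul_cancel k h e]
      refine Eq.trans ?_ (𝒢.mul_congr (𝒢.s_unit (𝒢.r h)) _ (h1 ▸ hx) rfl)
      exact (𝒢.unit_mul h).symm
    · exact 𝒢.kernel_of_ne _ e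

lemma IsCantor.regRep_diag_one (hG : 𝒢.IsCantor) : 𝒢.regRep (hG.diag 1) = 1 := by
  ext ξ k
  rw [hG.regRep_diag_apply]
  simp

variable (𝒢) in
/-- A continuous function on the unit space, pulled back along the range map. -/
noncomputable def pullR (g : C(X, ℂ)) : C(G, ℂ) := g.comp ⟨𝒢.r, 𝒢.continuous_r⟩

variable (𝒢) in
/-- A continuous function on the unit space, pulled back along the source map. -/
noncomputable def pullS (g : C(X, ℂ)) : C(G, ℂ) := g.comp ⟨𝒢.s, 𝒢.continuous_s⟩

lemma IsCantor.regRep_diag_mul (hG : 𝒢.IsCantor) (g : C(X, ℂ)) (f : C_c(G, ℂ)) :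
    𝒢.regRep (hG.diag g) * 𝒢.regRep f = 𝒢.regRep (mulCont f (𝒢.pullR g)) := by
  refine clm_ext_deltaVec fun b => lp.ext (funext fun a => ?_)
  rw [mul_apply_eq_comp, hG.regRep_diag_apply, regRep_deltaVec, regRep_deltaVec]
  by_cases e : 𝒢.s a = 𝒢.s b
  · rw [𝒢.kernel_of_eq _ e, 𝒢.kernel_of_eq _ e, mulCont_apply, mul_comm]
    change _ = _ * g (𝒢.r _)
    rw [𝒢.r_div]
  · rw [𝒢.kernel_of_ne _ e, 𝒢.kernel_of_ne _ e, mul_zero]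

lemma IsCantor.regRep_mul_diag (hG : 𝒢.IsCantor) (g : C(X, ℂ)) (f : C_c(G, ℂ)) :
    𝒢.regRep f * 𝒢.regRep (hG.diag g) = 𝒢.regRep (mulCont f (𝒢.pullS g)) := by
  refine clm_ext_deltaVec fun b => lp.ext (funext fun a => ?_)
  have h : 𝒢.regRep (hG.diag g) (deltaVec b) = g (𝒢.r b) • deltaVec b := by
    refine lp.ext (funext fun k => ?_)
    rw [hG.regRep_diag_apply, lp.coeFn_smul, Pi.smul_apply, deltaVec_apply]
    split_ifs with hk
    · rw [hk, smul_eq_mul]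
    · simp
  rw [mul_apply_eq_comp, h, map_smul, lp.coeFn_smul, Pi.smul_apply, regRep_deltaVec,
    regRep_deltaVec]
  by_cases e : 𝒢.s a = 𝒢.s b
  · rw [𝒢.kernel_of_eq _ e, 𝒢.kernel_of_eq _ e, mulCont_apply, smul_eq_mul, mul_comm]
    change _ = _ * g (𝒢.s _)
    rw [𝒢.s_div]
  · rw [𝒢.kernel_of_ne _ e, 𝒢.kernel_of_ne _ e, smul_zero]

/-! ### The reduced C*-algebra as a closure -/

/-- The operators `λ(f)` already form a unital *-algebra, so they are dense in the reduced
C*-algebra. -/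
lemma IsCantor.coe_reducedCStar (hG : 𝒢.IsCantor) :
    (𝒢.reducedCStar : Set (ℓ²(G, ℂ) →L[ℂ] ℓ²(G, ℂ))) = closure (Set.range 𝒢.regRep) := by
  let S : StarSubalgebra ℂ (ℓ²(G, ℂ) →L[ℂ] ℓ²(G, ℂ)) :=
    { carrier := Set.range 𝒢.regRep
      mul_mem' := by
        rintro _ _ ⟨f, rfl⟩ ⟨g, rfl⟩
        obtain ⟨F, hF⟩ := hG.exists_regRep_mul f g
        exact ⟨F, hF.symm⟩
      add_mem' := by
        rintro _ _ ⟨f, rfl⟩ ⟨g, rfl⟩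
        exact ⟨f + g, 𝒢.regRep_add f g⟩
      algebraMap_mem' := fun c =>
        ⟨c • hG.diag 1, by rw [regRep_smul, hG.regRep_diag_one, Algebra.algebraMap_eq_smul_one]⟩
      star_mem' := by
        rintro _ ⟨f, rfl⟩
        exact ⟨_, (𝒢.star_regRep f).symm⟩ }
  have h : StarAlgebra.adjoin ℂ (Set.range 𝒢.regRep) = S :=
    le_antisymm (StarAlgebra.adjoin_le le_rfl) fun a ha => StarAlgebra.subset_adjoin ℂ _ ha
  rw [reducedCStar, h, StarSubalgebra.topologicalClosure_coe]
  rfl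

lemma IsCantor.denseRange_toReduced (hG : 𝒢.IsCantor) : DenseRange 𝒢.toReduced := by
  intro a
  rw [closure_subtype, ← Set.range_comp]
  have := a.2
  rw [← SetLike.mem_coe, hG.coe_reducedCStar] at this
  exact this

end RDiscreteGroupoid

/-! ### Positive functionals on C*-algebras -/

section PositiveFunctional

variable {A : Type*} [CStarAlgebra A]

lemma exists_positiveLinearMap (τ : A →ₗ[ℂ] ℂ) (hτ : ∀ a, 0 ≤ τ (star a * a)) :
    letI := CStarAlgebra.spectralOrder A
    ∃ f : A →ₚ[ℂ] ℂ, ∀ a, f a = τ a := by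
  let := CStarAlgebra.spectralOrder A
  let := CStarAlgebra.spectralOrderedRing A
  refine ⟨PositiveLinearMap.mk₀ τ fun x hx => ?_, fun a => rfl⟩
  obtain ⟨y, rfl⟩ := CStarAlgebra.nonneg_iff_eq_star_mul_self.1 hx
  exact hτ y

lemma continuous_of_positive (τ : A →ₗ[ℂ] ℂ) (hτ : ∀ a, 0 ≤ τ (star a * a)) : Continuous τ := by
  let := CStarAlgebra.spectralOrder A
  let := CStarAlgebra.spectralOrderedRing A
  obtain ⟨f, hf⟩ := exists_positiveLinearMap τ hτ
  exact (map_continuous f).congr hf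

lemma map_star_of_positive (τ : A →ₗ[ℂ] ℂ) (hτ : ∀ a, 0 ≤ τ (star a * a)) (a : A) :
    τ (star a) = star (τ a) := by
  let := CStarAlgebra.spectralOrder A
  let := CStarAlgebra.spectralOrderedRing A
  obtain ⟨f, hf⟩ := exists_positiveLinearMap τ hτ
  rw [← hf, ← hf]
  exact map_star f a

/-- The Cauchy–Schwarz inequality for a positive functional. -/
lemma norm_sq_le_of_positive (τ : A →ₗ[ℂ] ℂ) (hτ : ∀ a, 0 ≤ τ (star a * a)) (a b : A) :
    ‖τ (star a * b)‖ ^ 2 ≤ ‖τ (star a * a)‖ * ‖τ (star b * b)‖ := by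
  let := CStarAlgebra.spectralOrder A
  let := CStarAlgebra.spectralOrderedRing A
  obtain ⟨f, hf⟩ := exists_positiveLinearMap τ hτ
  have h := norm_inner_le_norm (𝕜 := ℂ) (f.toPreGNS a) (f.toPreGNS b)
  have hn : ∀ c : A, ‖τ (star c * c)‖ = ‖f.toPreGNS c‖ ^ 2 := by
    intro c
    have h1 := f.preGNS_norm_sq (f.toPreGNS c)
    rw [f.ofPreGNS_toPreGNS, hf] at h1
    rw [← h1, norm_pow, Complex.norm_real, norm_norm]
  rw [hn, hn, ← mul_pow, ← hf]
  exact pow_le_pow_left₀ (norm_nonneg _) h 2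

end PositiveFunctional

namespace RDiscreteGroupoid

variable {X G : Type*} [TopologicalSpace X] [TopologicalSpace G] (𝒢 : RDiscreteGroupoid X G)

instance isClosed_reducedCStar :
    IsClosed (𝒢.reducedCStar : Set (ℓ²(G, ℂ) →L[ℂ] ℓ²(G, ℂ))) :=
  StarSubalgebra.isClosed_topologicalClosure _

/-! The following three facts are instances of general facts on C*-algebras, stated for the
algebraic structure which the reduced C*-algebra has as a subalgebra. -/

variable {𝒢} in
lemma continuous_of_nonneg (τ : 𝒢.reducedCStar →ₗ[ℂ] ℂ) (hτ : ∀ a, 0 ≤ τ (star a * a)) :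
    Continuous τ :=
  continuous_of_positive (A := 𝒢.reducedCStar) τ hτ

variable {𝒢} in
lemma map_star_of_nonneg (τ : 𝒢.reducedCStar →ₗ[ℂ] ℂ) (hτ : ∀ a, 0 ≤ τ (star a * a))
    (a : 𝒢.reducedCStar) : τ (star a) = star (τ a) :=
  map_star_of_positive (A := 𝒢.reducedCStar) τ hτ a

variable {𝒢} in
lemma norm_sq_le_of_nonneg (τ : 𝒢.reducedCStar →ₗ[ℂ] ℂ) (hτ : ∀ a, 0 ≤ τ (star a * a))
    (a b : 𝒢.reducedCStar) : ‖τ (star a * b)‖ ^ 2 ≤ ‖τ (star a * a)‖ * ‖τ (star b * b)‖ :=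
  norm_sq_le_of_positive (A := 𝒢.reducedCStar) τ hτ a b

lemma toReduced_add (f g : C_c(G, ℂ)) : 𝒢.toReduced (f + g) = 𝒢.toReduced f + 𝒢.toReduced g :=
  Subtype.ext (𝒢.regRep_add f g)

lemma toReduced_smul (c : ℂ) (f : C_c(G, ℂ)) : 𝒢.toReduced (c • f) = c • 𝒢.toReduced f :=
  Subtype.ext (𝒢.regRep_smul c f)

lemma toReduced_zero : 𝒢.toReduced 0 = 0 := by
  rw [← zero_smul ℂ (0 : C_c(G, ℂ)), toReduced_smul, zero_smul]

lemma star_toReduced (f : C_c(G, ℂ)) : star (𝒢.toReduced f) = 𝒢.toReduced (𝒢.involution f) :=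
  Subtype.ext (𝒢.star_regRep f)

variable {𝒢} in
lemma map_toReduced_add (τ : 𝒢.reducedCStar →ₗ[ℂ] ℂ) (f g : C_c(G, ℂ)) :
    τ (𝒢.toReduced (f + g)) = τ (𝒢.toReduced f) + τ (𝒢.toReduced g) := by
  rw [toReduced_add, map_add]

variable {𝒢} in
lemma map_toReduced_smul (τ : 𝒢.reducedCStar →ₗ[ℂ] ℂ) (c : ℂ) (f : C_c(G, ℂ)) :
    τ (𝒢.toReduced (c • f)) = c * τ (𝒢.toReduced f) := by
  rw [toReduced_smul, map_smul, smul_eq_mul]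

variable {𝒢} in
lemma map_toReduced_zero (τ : 𝒢.reducedCStar →ₗ[ℂ] ℂ) : τ (𝒢.toReduced 0) = 0 := by
  rw [toReduced_zero, map_zero]

variable {𝒢}

lemma IsCantor.toReduced_diag_one (hG : 𝒢.IsCantor) : 𝒢.toReduced (hG.diag 1) = 1 :=
  Subtype.ext hG.regRep_diag_one

lemma IsCantor.toReduced_diag_mul (hG : 𝒢.IsCantor) (g : C(X, ℂ)) (f : C_c(G, ℂ)) :
    𝒢.toReduced (hG.diag g) * 𝒢.toReduced f = 𝒢.toReduced (mulCont f (𝒢.pullR g)) :=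
  Subtype.ext (hG.regRep_diag_mul g f)

lemma IsCantor.toReduced_mul_diag (hG : 𝒢.IsCantor) (g : C(X, ℂ)) (f : C_c(G, ℂ)) :
    𝒢.toReduced f * 𝒢.toReduced (hG.diag g) = 𝒢.toReduced (mulCont f (𝒢.pullS g)) :=
  Subtype.ext (hG.regRep_mul_diag g f)

lemma IsCantor.diag_add (hG : 𝒢.IsCantor) (g h : C(X, ℂ)) :
    hG.diag (g + h) = hG.diag g + hG.diag h := by
  ext k
  rw [CompactlySupportedContinuousMap.add_apply]
  by_cases hk : k ∈ Set.range 𝒢.unit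
  · obtain ⟨x, rfl⟩ := hk
    simp [hG.diag_unit]
  · simp [hG.diag_of_notMem _ hk]

lemma IsCantor.diag_smul (hG : 𝒢.IsCantor) (c : ℂ) (g : C(X, ℂ)) :
    hG.diag (c • g) = c • hG.diag g := by
  ext k
  rw [CompactlySupportedContinuousMap.smul_apply]
  by_cases hk : k ∈ Set.range 𝒢.unit
  · obtain ⟨x, rfl⟩ := hk
    simp [hG.diag_unit]
  · simp [hG.diag_of_notMem _ hk]

lemma IsCantor.mulCont_diag_pullR (hG : 𝒢.IsCantor) (g h : C(X, ℂ)) :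
    mulCont (hG.diag h) (𝒢.pullR g) = hG.diag (g * h) := by
  ext k
  rw [mulCont_apply]
  by_cases hk : k ∈ Set.range 𝒢.unit
  · obtain ⟨x, rfl⟩ := hk
    rw [hG.diag_unit, hG.diag_unit, mul_comm]
    change g (𝒢.r _) * _ = _
    rw [𝒢.r_unit]
    rfl
  · rw [hG.diag_of_notMem _ hk, hG.diag_of_notMem _ hk, zero_mul]

lemma IsCantor.involution_diag (hG : 𝒢.IsCantor) (g : C(X, ℂ)) :
    𝒢.involution (hG.diag g) = hG.diag (star g) := by
  ext k
  rw [involution_apply]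
  by_cases hk : k ∈ Set.range 𝒢.unit
  · obtain ⟨x, rfl⟩ := hk
    rw [𝒢.inv_unit, hG.diag_unit, hG.diag_unit]
    rfl
  · rw [hG.diag_of_notMem _ hk, hG.diag_of_notMem, star_zero]
    rintro ⟨x, hx⟩
    exact hk ⟨x, by rw [← 𝒢.inv_inv k, ← hx, 𝒢.inv_unit]⟩

lemma IsCantor.toReduced_diag_mul_diag (hG : 𝒢.IsCantor) (g h : C(X, ℂ)) :
    𝒢.toReduced (hG.diag g) * 𝒢.toReduced (hG.diag h) = 𝒢.toReduced (hG.diag (g * h)) := by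
  rw [hG.toReduced_diag_mul, hG.mulCont_diag_pullR]

lemma IsCantor.star_toReduced_diag (hG : 𝒢.IsCantor) (g : C(X, ℂ)) :
    star (𝒢.toReduced (hG.diag g)) = 𝒢.toReduced (hG.diag (star g)) := by
  rw [star_toReduced, hG.involution_diag]

/-! ### The trace of an invariant measure -/

variable (𝒢) in
/-- The diagonal entry of an operator on `ℓ²(G)` at the unit `x`. On the reduced C*-algebra, this is
the canonical conditional expectation onto `C(X)`, evaluated at `x`. -/
noncomputable def expect (a : ℓ²(G, ℂ) →L[ℂ] ℓ²(G, ℂ)) (x : X) : ℂ :=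
  a (deltaVec (𝒢.unit x)) (𝒢.unit x)

lemma norm_expect_le (a : ℓ²(G, ℂ) →L[ℂ] ℓ²(G, ℂ)) (x : X) : ‖𝒢.expect a x‖ ≤ ‖a‖ := by
  refine (norm_lp_apply_le _ _).trans ?_
  simpa [norm_deltaVec] using a.le_opNorm (deltaVec (𝒢.unit x))

lemma expect_sub (a b : ℓ²(G, ℂ) →L[ℂ] ℓ²(G, ℂ)) (x : X) :
    𝒢.expect (a - b) x = 𝒢.expect a x - 𝒢.expect b x := rfl

lemma expect_regRep (f : C_c(G, ℂ)) (x : X) : 𝒢.expect (𝒢.regRep f) x = f (𝒢.unit x) := by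
  rw [expect, regRep_deltaVec, 𝒢.kernel_of_eq _ rfl, 𝒢.div_self, 𝒢.r_unit]

lemma expect_star_mul_self (a : ℓ²(G, ℂ) →L[ℂ] ℓ²(G, ℂ)) (x : X) :
    𝒢.expect (star a * a) x = ((‖a (deltaVec (𝒢.unit x))‖ ^ 2 : ℝ) : ℂ) := by
  rw [expect, ← inner_deltaVec_left, mul_apply_eq_comp, ContinuousLinearMap.star_eq_adjoint,
    ContinuousLinearMap.adjoint_inner_right, inner_self_eq_norm_sq_to_K]
  norm_cast

/-- The value at the unit `x` of the convolution of `f` and `g`. -/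
lemma expect_regRep_mul (f g : C_c(G, ℂ)) (x : X) :
    𝒢.expect (𝒢.regRep f * 𝒢.regRep g) x = ∑' h : {h : G // 𝒢.s h = x}, f (𝒢.inv h) * g h := by
  rw [expect, mul_apply_eq_comp, regRep_eq_tsum_kernel]
  simp only [regRep_deltaVec]
  have h1 : Function.support (fun m => 𝒢.kernel f (𝒢.unit x) m * 𝒢.kernel g m (𝒢.unit x)) ⊆
      {m | 𝒢.s m = x} := by
    intro m hm
    by_contra hne
    refine hm (mul_eq_zero_of_right _ (𝒢.kernel_of_ne g ?_))
    rwa [𝒢.s_unit]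
  rw [← tsum_subtype_eq_of_support_subset h1]
  refine tsum_congr fun m => ?_
  have hm : 𝒢.s (m : G) = 𝒢.s (𝒢.unit x) := m.2.trans (𝒢.s_unit x).symm
  rw [𝒢.kernel_of_eq _ hm.symm, 𝒢.kernel_of_eq _ hm, 𝒢.unit_div, 𝒢.div_unit]

/-- The diagonal entries of an operator in the reduced C*-algebra are a uniform limit of functions
`f|_X`, `f ∈ C_c(G)`. -/
lemma IsCantor.continuous_expect (hG : 𝒢.IsCantor) {a : ℓ²(G, ℂ) →L[ℂ] ℓ²(G, ℂ)}
    (ha : a ∈ 𝒢.reducedCStar) : Continuous (𝒢.expect a) := by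
  rw [← SetLike.mem_coe, hG.coe_reducedCStar, mem_closure_iff_seq_limit] at ha
  obtain ⟨b, hb, hlim⟩ := ha
  have hu : TendstoUniformly (fun n => 𝒢.expect (b n)) (𝒢.expect a) Filter.atTop := by
    rw [Metric.tendstoUniformly_iff]
    intro ε hε
    filter_upwards [Metric.tendsto_nhds.1 hlim ε hε] with n hn x
    rw [dist_comm, dist_eq_norm, ← expect_sub]
    exact (norm_expect_le _ x).trans_lt (by rwa [← dist_eq_norm])
  refine hu.continuous (Filter.Frequently.of_forall fun n => ?_)
  obtain ⟨f, hf⟩ := hb n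
  rw [← hf]
  exact (f.continuous.comp 𝒢.continuous_unit).congr fun x => (expect_regRep f x).symm

variable [MeasurableSpace X] [BorelSpace X]

lemma IsCantor.integrable_of_continuous (hG : 𝒢.IsCantor) (μ : Measure X) [IsFiniteMeasure μ]
    {φ : X → ℂ} (hφ : Continuous φ) : Integrable φ μ := by
  have := hG.compactSpace
  exact hφ.integrable_of_hasCompactSupport (HasCompactSupport.of_compactSpace _)

/-- Integration of the conditional expectation, as a linear functional on the reduced C*-algebra. -/
noncomputable def IsCantor.traceOf (hG : 𝒢.IsCantor) (μ : Measure X) [IsFiniteMeasure μ] :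
    𝒢.reducedCStar →ₗ[ℂ] ℂ where
  toFun a := ∫ x, 𝒢.expect a x ∂μ
  map_add' a b := integral_add (hG.integrable_of_continuous μ (hG.continuous_expect a.2))
    (hG.integrable_of_continuous μ (hG.continuous_expect b.2))
  map_smul' c _ := integral_const_mul c _

lemma IsCantor.traceOf_apply (hG : 𝒢.IsCantor) (μ : Measure X) [IsFiniteMeasure μ]
    (a : 𝒢.reducedCStar) : hG.traceOf μ a = ∫ x, 𝒢.expect a x ∂μ := rfl

lemma IsCantor.traceOf_toReduced (hG : 𝒢.IsCantor) (μ : Measure X) [IsFiniteMeasure μ]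
    (f : C_c(G, ℂ)) : hG.traceOf μ (𝒢.toReduced f) = ∫ x, f (𝒢.unit x) ∂μ :=
  integral_congr_ae (.of_forall fun x => expect_regRep f x)

lemma IsCantor.traceOf_nonneg (hG : 𝒢.IsCantor) (μ : Measure X) [IsFiniteMeasure μ]
    (a : 𝒢.reducedCStar) : 0 ≤ hG.traceOf μ (star a * a) := by
  have h : hG.traceOf μ (star a * a) =
      ((∫ x, ‖a.1 (deltaVec (𝒢.unit x))‖ ^ 2 ∂μ : ℝ) : ℂ) := by
    rw [hG.traceOf_apply, ← integral_complex_ofReal]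
    exact integral_congr_ae (.of_forall fun x => expect_star_mul_self a.1 x)
  rw [h]
  exact_mod_cast integral_nonneg fun x => by positivity

lemma IsCantor.continuous_traceOf (hG : 𝒢.IsCantor) (μ : Measure X) [IsFiniteMeasure μ] :
    Continuous (hG.traceOf μ) :=
  continuous_of_nonneg _ (hG.traceOf_nonneg μ)

lemma IsCantor.traceOf_toReduced_mul (hG : 𝒢.IsCantor) (μ : Measure X) [IsFiniteMeasure μ]
    (f g : C_c(G, ℂ)) : hG.traceOf μ (𝒢.toReduced f * 𝒢.toReduced g) =
      ∫ x, (∑' h : {h : G // 𝒢.s h = x}, f (𝒢.inv h) * g h) ∂μ :=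
  integral_congr_ae (.of_forall fun x => expect_regRep_mul f g x)

/-- For an invariant measure, `∫ ∑_{s(h) = x} f(h⁻¹) g(h)` is symmetric in `f` and `g`. -/
lemma IsCantor.isNormalizedTrace_traceOf (hG : 𝒢.IsCantor) (μ : Measure X)
    [IsProbabilityMeasure μ] (hμ : 𝒢.IsInvariant μ) : IsNormalizedTrace (hG.traceOf μ) where
  nonneg := hG.traceOf_nonneg μ
  map_mul_comm := by
    have hc := hG.continuous_traceOf μ
    refine fun a b => hG.denseRange_toReduced.induction_on₂
      (p := fun a b => hG.traceOf μ (a * b) = hG.traceOf μ (b * a)) ?_ ?_ a b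
    · exact isClosed_eq (hc.comp (continuous_fst.mul continuous_snd))
        (hc.comp (continuous_snd.mul continuous_fst))
    · intro f g
      rw [hG.traceOf_toReduced_mul, hG.traceOf_toReduced_mul]
      have h1 := hμ (mulCont g ⟨fun h => f (𝒢.inv h), f.continuous.comp 𝒢.continuous_inv⟩)
      have h2 : ∀ x, (∑' h : {h : G // 𝒢.s h = x}, f (𝒢.inv h) * g h) =
          ∑' h : {h : G // 𝒢.s h = x},
            mulCont g ⟨fun h => f (𝒢.inv h), f.continuous.comp 𝒢.continuous_inv⟩ h :=
        fun x => tsum_congr fun h => mul_comm _ _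
      have h3 : ∀ x, (∑' h : {h : G // 𝒢.s h = x}, g (𝒢.inv h) * f h) =
          ∑' h : {h : G // 𝒢.r h = x},
            mulCont g ⟨fun h => f (𝒢.inv h), f.continuous.comp 𝒢.continuous_inv⟩ h := by
        intro x
        rw [← (𝒢.invFibreEquiv x).tsum_eq]
        refine tsum_congr fun h => ?_
        rw [mulCont_apply]
        change _ = g (𝒢.inv h) * f (𝒢.inv (𝒢.inv h))
        rw [𝒢.inv_inv]
      simp only [h2, h3]
      exact h1.symm
  map_one := by
    rw [← hG.toReduced_diag_one, hG.traceOf_toReduced]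
    simp [hG.diag_unit]

/-- A trace which is integration over the unit space on `C_c(G)` is integration of the conditional
expectation. -/
lemma IsCantor.eq_traceOf (hG : 𝒢.IsCantor) (μ : Measure X) [IsFiniteMeasure μ]
    {τ : 𝒢.reducedCStar →ₗ[ℂ] ℂ} (hτ : IsNormalizedTrace τ)
    (h : ∀ f : C_c(G, ℂ), τ (𝒢.toReduced f) = ∫ x, f (𝒢.unit x) ∂μ) : τ = hG.traceOf μ := by
  refine LinearMap.ext fun a => congrFun (hG.denseRange_toReduced.equalizer
    (continuous_of_nonneg τ hτ.nonneg) (hG.continuous_traceOf μ) (funext fun f => ?_)) a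
  exact (h f).trans (hG.traceOf_toReduced μ f).symm

/-- If integration over the unit space is a trace, then the measure is invariant: apply the trace
property to `f` and a function which is `1` on the inverses of the points of the support of `f`. -/
lemma IsCantor.isInvariant_of_trace (hG : 𝒢.IsCantor) (μ : Measure X) [IsFiniteMeasure μ]
    {τ : 𝒢.reducedCStar →ₗ[ℂ] ℂ} (hτ : IsNormalizedTrace τ)
    (h : ∀ f : C_c(G, ℂ), τ (𝒢.toReduced f) = ∫ x, f (𝒢.unit x) ∂μ) : 𝒢.IsInvariant μ := by
  have := hG.t2Space
  have := hG.locallyCompactSpace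
  intro f
  obtain ⟨φ, hφ1, -, hφc, -⟩ := exists_continuous_one_zero_of_isCompact
    (f.hasCompactSupport.isCompact.image 𝒢.continuous_inv) isClosed_empty (Set.disjoint_empty _)
  have hφ : ∀ k, complexify φ hφc (𝒢.inv k) * f k = f k := by
    intro k
    by_cases hk : f k = 0
    · rw [hk, mul_zero]
    · have h1 : φ (𝒢.inv k) = 1 := hφ1 ⟨k, subset_tsupport _ hk, rfl⟩
      have h2 : complexify φ hφc (𝒢.inv k) = 1 := by
        change ((φ (𝒢.inv k) : ℝ) : ℂ) = 1
        rw [h1, Complex.ofReal_one]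
      rw [h2, one_mul]
  have key := hτ.map_mul_comm (𝒢.toReduced (complexify φ hφc)) (𝒢.toReduced f)
  rw [hG.eq_traceOf μ hτ h, hG.traceOf_toReduced_mul, hG.traceOf_toReduced_mul] at key
  simp only [hφ] at key
  rw [key]
  refine integral_congr_ae (.of_forall fun x => ?_)
  refine ((𝒢.invFibreEquiv x).tsum_eq fun k => f k).symm.trans (tsum_congr fun k => ?_)
  change f (𝒢.inv k) = _
  have hk := hφ (𝒢.inv k)
  rw [𝒢.inv_inv, mul_comm] at hk
  exact hk.symm

end RDiscreteGroupoid

namespace RDiscreteGroupoid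

variable {X G : Type*} [TopologicalSpace X] [TopologicalSpace G] {𝒢 : RDiscreteGroupoid X G}

/-! ### The measure of a trace -/

/-- The complexification of a real continuous function. -/
noncomputable def ofRealCont {Y : Type*} [TopologicalSpace Y] (g : C(Y, ℝ)) : C(Y, ℂ) :=
  ⟨fun y => g y, Complex.continuous_ofReal.comp g.continuous⟩

/-- The restriction of a trace to `C(X)`, as a real positive functional. -/
noncomputable def IsCantor.realFunctional (hG : 𝒢.IsCantor) {τ : 𝒢.reducedCStar →ₗ[ℂ] ℂ}
    (hτ : IsNormalizedTrace τ) : C_c(X, ℝ) →ₚ[ℝ] ℝ :=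
  PositiveLinearMap.mk₀
    { toFun := fun g => (τ (𝒢.toReduced (hG.diag (ofRealCont g.toContinuousMap)))).re
      map_add' := fun g h => by
        have : ofRealCont (g + h).toContinuousMap =
            ofRealCont g.toContinuousMap + ofRealCont h.toContinuousMap := by
          ext x
          simp [ofRealCont]
        rw [this, hG.diag_add, map_toReduced_add, Complex.add_re]
      map_smul' := fun c g => by
        have : ofRealCont (c • g).toContinuousMap = (c : ℂ) • ofRealCont g.toContinuousMap := by
          ext x
          simp [ofRealCont]
        rw [this, hG.diag_smul, map_toReduced_smul, Complex.re_ofReal_mul]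
        rfl }
    -- a nonnegative `g` is `h* h` for `h = √g`
    (fun g hg => by
      have hg' : ∀ x, 0 ≤ g x := hg
      let h : C(X, ℂ) := ofRealCont ⟨fun x => √(g x), Real.continuous_sqrt.comp g.continuous⟩
      have e : ofRealCont g.toContinuousMap = star h * h := by
        ext x
        change ((g x : ℝ) : ℂ) = star ((√(g x) : ℝ) : ℂ) * ((√(g x) : ℝ) : ℂ)
        rw [Complex.star_def, Complex.conj_ofReal, ← Complex.ofReal_mul, Real.mul_self_sqrt (hg' x)]
      have := hτ.nonneg (𝒢.toReduced (hG.diag h))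
      rw [hG.star_toReduced_diag, hG.toReduced_diag_mul_diag, ← e] at this
      exact (Complex.nonneg_iff.1 this).1)

/-- Riesz representation: a trace is given on `C(X)` by a Borel probability measure. -/
lemma IsCantor.exists_measure [MeasurableSpace X] [BorelSpace X] (hG : 𝒢.IsCantor)
    {τ : 𝒢.reducedCStar →ₗ[ℂ] ℂ} (hτ : IsNormalizedTrace τ) :
    ∃ μ : ProbabilityMeasure X, ∀ g : C(X, ℂ),
      τ (𝒢.toReduced (hG.diag g)) = ∫ x, g x ∂(μ : Measure X) := by
  have := hG.compactSpace
  have := hG.t2Space_unit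
  set μ := RealRMK.rieszMeasure (hG.realFunctional hτ)
  have hfin : IsFiniteMeasure μ := ⟨isCompact_univ.measure_lt_top⟩
  -- the trace is real on self-adjoint elements
  have hre : ∀ g : C(X, ℝ),
      τ (𝒢.toReduced (hG.diag (ofRealCont g))) = ((∫ x, g x ∂μ : ℝ) : ℂ) := by
    intro g
    have h1 : ∫ x, g x ∂μ = (τ (𝒢.toReduced (hG.diag (ofRealCont g)))).re :=
      RealRMK.integral_rieszMeasure (hG.realFunctional hτ)
        (CompactlySupportedContinuousMap.continuousMapEquiv g)
    have h2 : star (ofRealCont g) = ofRealCont g := by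
      ext x
      exact Complex.conj_ofReal _
    have h3 := map_star_of_nonneg τ hτ.nonneg (𝒢.toReduced (hG.diag (ofRealCont g)))
    rw [hG.star_toReduced_diag, h2] at h3
    rw [h1]
    exact (Complex.conj_eq_iff_re.1 h3.symm).symm
  have hone : IsProbabilityMeasure μ := by
    have h1 := hre 1
    have h2 : ofRealCont (1 : C(X, ℝ)) = 1 := by
      ext x
      simp [ofRealCont]
    rw [h2, hG.toReduced_diag_one, hτ.map_one] at h1
    have h3 : μ.real Set.univ = 1 := by
      simp only [ContinuousMap.one_apply, integral_const, smul_eq_mul, mul_one] at h1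
      exact_mod_cast h1.symm
    exact ⟨by rwa [measureReal_def, ENNReal.toReal_eq_one_iff] at h3⟩
  refine ⟨⟨μ, hone⟩, fun g => ?_⟩
  let u : C(X, ℝ) := ⟨fun x => (g x).re, Complex.continuous_re.comp g.continuous⟩
  let v : C(X, ℝ) := ⟨fun x => (g x).im, Complex.continuous_im.comp g.continuous⟩
  have hg : g = ofRealCont u + Complex.I • ofRealCont v := by
    ext x
    change g x = ((g x).re : ℂ) + Complex.I * ((g x).im : ℂ)
    rw [mul_comm, Complex.re_add_im]
  have hint := hG.integrable_of_continuous μ g.continuous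
  conv_lhs => rw [hg]
  rw [hG.diag_add, hG.diag_smul, map_toReduced_add, map_toReduced_smul, hre, hre, mul_comm]
  exact integral_re_add_im hint

/-! ### Traces of principal groupoids -/

lemma IsCantor.toReduced_diag_clopenInd_mul_self (hG : 𝒢.IsCantor) {A : Set X} (hA : IsClopen A) :
    𝒢.toReduced (hG.diag (clopenInd hA)) * 𝒢.toReduced (hG.diag (clopenInd hA)) =
      𝒢.toReduced (hG.diag (clopenInd hA)) := by
  rw [hG.toReduced_diag_mul_diag]
  congr 2
  ext x
  rw [ContinuousMap.mul_apply]
  by_cases hx : x ∈ A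
  · rw [clopenInd_of_mem hA hx, mul_one]
  · rw [clopenInd_of_notMem hA hx, mul_zero]

/-- A trace vanishes on functions supported on the arrows from a clopen set `A` to its
complement: such a function is `f 1_A`, and `1_A f = 0`. -/
lemma IsCantor.trace_eq_zero_of_clopen (hG : 𝒢.IsCantor) {τ : 𝒢.reducedCStar →ₗ[ℂ] ℂ}
    (hτ : IsNormalizedTrace τ) {A : Set X} (hA : IsClopen A) (f : C_c(G, ℂ))
    (hf : ∀ k, f k ≠ 0 → 𝒢.s k ∈ A ∧ 𝒢.r k ∉ A) : τ (𝒢.toReduced f) = 0 := by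
  have h1 : mulCont f (𝒢.pullS (clopenInd hA)) = f := by
    ext k
    rw [mulCont_apply]
    by_cases hk : f k = 0
    · rw [hk, zero_mul]
    · have : 𝒢.pullS (clopenInd hA) k = 1 := clopenInd_of_mem hA (hf k hk).1
      rw [this, mul_one]
  have h2 : mulCont f (𝒢.pullR (clopenInd hA)) = 0 := by
    ext k
    rw [mulCont_apply, CompactlySupportedContinuousMap.zero_apply]
    by_cases hk : f k = 0
    · rw [hk, zero_mul]
    · have : 𝒢.pullR (clopenInd hA) k = 0 := clopenInd_of_notMem hA (hf k hk).2
      rw [this, mul_zero]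
  have h3 : 𝒢.toReduced f = 𝒢.toReduced f * 𝒢.toReduced (hG.diag (clopenInd hA)) := by
    rw [hG.toReduced_mul_diag, h1]
  rw [h3, hτ.map_mul_comm, hG.toReduced_diag_mul, h2, map_toReduced_zero]

lemma IsCantor.trace_eq_zero_of_cover (hG : 𝒢.IsCantor) {τ : 𝒢.reducedCStar →ₗ[ℂ] ℂ}
    (hτ : IsNormalizedTrace τ) {ι : Type*} (A : ι → Set X) (hA : ∀ i, IsClopen (A i))
    (t : Finset ι) (f : C_c(G, ℂ))
    (hf : ∀ k, f k ≠ 0 → ∃ i ∈ t, 𝒢.s k ∈ A i ∧ 𝒢.r k ∉ A i) : τ (𝒢.toReduced f) = 0 := by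
  classical
  induction t using Finset.induction_on generalizing f with
  | empty =>
    have : f = 0 := by
      ext k
      by_contra hk
      simpa using hf k hk
    rw [this, map_toReduced_zero]
  | insert i t _ ih =>
    have hW : IsClopen (𝒢.s ⁻¹' A i ∩ (𝒢.r ⁻¹' A i)ᶜ) :=
      ((hA i).preimage 𝒢.continuous_s).inter ((hA i).preimage 𝒢.continuous_r).compl
    rw [eq_mulCont_add_mulCont f hW, map_toReduced_add]
    rw [hG.trace_eq_zero_of_clopen hτ (hA i) _ fun k hk => ?_, ih _ fun k hk => ?_, add_zero]
    · rw [mulCont_apply] at hk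
      obtain ⟨j, hj, hkj⟩ := hf k (left_ne_zero_of_mul hk)
      rcases Finset.mem_insert.1 hj with rfl | hj
      · exact absurd (clopenInd_of_notMem hW.compl (not_not.2 hkj)) (right_ne_zero_of_mul hk)
      · exact ⟨j, hj, hkj⟩
    · by_contra h
      exact hk (by rw [mulCont_apply, clopenInd_of_notMem hW h, mul_zero])

/-- On a principal groupoid, a trace vanishes on functions which vanish on the units: every other
arrow starts in some clopen set `A` and ends outside of it. -/
lemma IsCantor.trace_eq_zero_of_principal (hG : 𝒢.IsCantor) (hp : 𝒢.IsPrincipal)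
    {τ : 𝒢.reducedCStar →ₗ[ℂ] ℂ} (hτ : IsNormalizedTrace τ) (f : C_c(G, ℂ))
    (hf : ∀ x, f (𝒢.unit x) = 0) : τ (𝒢.toReduced f) = 0 := by
  have := hG.compactSpace
  have := hG.t2Space_unit
  have := hG.totallyDisconnectedSpace
  have hsupp : ∀ k ∈ tsupport f, 𝒢.r k ≠ 𝒢.s k := by
    intro k hk hrs
    have h1 : tsupport f ⊆ (Set.range 𝒢.unit)ᶜ := by
      refine closure_minimal ?_ hG.isClopen_range_unit.compl.1
      rintro k hk ⟨x, rfl⟩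
      exact hk (hf x)
    exact h1 hk ⟨_, (hp k hrs).symm⟩
  have hex : ∀ k : {k : G // 𝒢.r k ≠ 𝒢.s k}, ∃ A : Set X, IsClopen A ∧ 𝒢.s k ∈ A ∧ 𝒢.r k ∉ A := by
    rintro ⟨k, hk⟩
    obtain ⟨A, hA, hsA, hrA⟩ := compact_exists_isClopen_in_isOpen (isOpen_ne (x := 𝒢.r k))
      (show 𝒢.s k ∈ {y | y ≠ 𝒢.r k} from hk.symm)
    exact ⟨A, hA, hsA, fun h => hrA h rfl⟩
  choose A hA hsA hrA using hex
  obtain ⟨t, ht⟩ := f.hasCompactSupport.elim_finite_subcover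
    (fun i => 𝒢.s ⁻¹' A i ∩ (𝒢.r ⁻¹' A i)ᶜ)
    (fun i => (((hA i).preimage 𝒢.continuous_s).inter ((hA i).preimage 𝒢.continuous_r).compl).2)
    (fun k hk => Set.mem_iUnion.2 ⟨⟨k, hsupp k hk⟩, hsA _, hrA _⟩)
  refine hG.trace_eq_zero_of_cover hτ A hA t f fun k hk => ?_
  obtain ⟨i, hi, hki⟩ := Set.mem_iUnion₂.1 (ht (subset_tsupport _ hk))
  exact ⟨i, hi, hki⟩

variable [MeasurableSpace X] [BorelSpace X]

/-- The map from invariant probability measures to normalized traces. -/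
noncomputable def IsCantor.measureToTrace (hG : 𝒢.IsCantor) (μ : 𝒢.InvariantProbability) :
    NormalizedTrace 𝒢.reducedCStar :=
  ⟨hG.traceOf (μ.1 : Measure X), hG.isNormalizedTrace_traceOf _ μ.2⟩

lemma IsCantor.measureToTrace_apply (hG : 𝒢.IsCantor) (μ : 𝒢.InvariantProbability) :
    (hG.measureToTrace μ).1 = hG.traceOf (μ.1 : Measure X) := rfl

lemma IsCantor.measureToTrace_injective (hG : 𝒢.IsCantor) :
    Function.Injective hG.measureToTrace := by
  have := hG.compactSpace
  have := hG.t2Space_unit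
  have := hG.secondCountable_unit
  have := TopologicalSpace.metrizableSpace_of_t3_secondCountable X
  intro μ ν h
  suffices e : (μ.1 : Measure X) = (ν.1 : Measure X) from Subtype.ext (Subtype.ext e)
  refine ext_of_forall_integral_eq_of_IsFiniteMeasure fun g => ?_
  have h1 : hG.traceOf (μ.1 : Measure X) (𝒢.toReduced (hG.diag (ofRealCont g.toContinuousMap))) =
      hG.traceOf (ν.1 : Measure X) (𝒢.toReduced (hG.diag (ofRealCont g.toContinuousMap))) := by
    rw [← measureToTrace_apply, h, measureToTrace_apply]
  rw [hG.traceOf_toReduced, hG.traceOf_toReduced] at h1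
  simp only [hG.diag_unit] at h1
  change ∫ x, ((g x : ℝ) : ℂ) ∂(μ.1 : Measure X) = ∫ x, ((g x : ℝ) : ℂ) ∂(ν.1 : Measure X) at h1
  rw [integral_complex_ofReal, integral_complex_ofReal] at h1
  exact_mod_cast h1

/-- A trace which is integration over the unit space on `C_c(G)` comes from an invariant
measure. -/
lemma IsCantor.exists_measureToTrace_eq (hG : 𝒢.IsCantor) (τ : NormalizedTrace 𝒢.reducedCStar)
    (μ : ProbabilityMeasure X)
    (h : ∀ f : C_c(G, ℂ), τ.1 (𝒢.toReduced f) = ∫ x, f (𝒢.unit x) ∂(μ : Measure X)) :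
    ∃ ν, hG.measureToTrace ν = τ :=
  ⟨⟨μ, hG.isInvariant_of_trace _ τ.2 h⟩, Subtype.ext (hG.eq_traceOf _ τ.2 h).symm⟩

lemma IsCantor.measureToTrace_surjective_of_principal (hG : 𝒢.IsCantor) (hp : 𝒢.IsPrincipal) :
    Function.Surjective hG.measureToTrace := by
  intro τ
  obtain ⟨μ, hμ⟩ := hG.exists_measure τ.2
  refine hG.exists_measureToTrace_eq τ μ fun f => ?_
  let g : C(X, ℂ) := ⟨fun x => f (𝒢.unit x), f.continuous.comp 𝒢.continuous_unit⟩
  have e : f = (f - hG.diag g) + hG.diag g := (sub_add_cancel f _).symm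
  rw [e, map_toReduced_add, hG.trace_eq_zero_of_principal hp τ.2, zero_add, hμ, ← e]
  · rfl
  · intro x
    rw [CompactlySupportedContinuousMap.sub_apply, hG.diag_unit]
    exact sub_self _

end RDiscreteGroupoid

/-! ### Sums over the fibres of a map -/

section FibreSums

variable {X G : Type*}

/-- The sum over a fibre of a function supported in a set which meets the fibre in a finite set. -/
lemma tsum_fibre_eq_sum (t : G → X) {S : Set G} {x : X} (hfin : {g | g ∈ S ∧ t g = x}.Finite)
    {φ : G → ℂ} (hφ : ∀ g, φ g ≠ 0 → g ∈ S) :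
    ∑' g : {g : G // t g = x}, φ g = ∑ g ∈ hfin.toFinset, φ g := by
  classical
  have h1 : ∑' g : {g : G // t g = x}, φ g = ∑' g, ({g : G | t g = x}.indicator φ) g :=
    tsum_subtype _ _
  rw [h1, tsum_eq_sum (s := hfin.toFinset)]
  · refine Finset.sum_congr rfl fun g hg => Set.indicator_of_mem ?_ _
    exact ((Set.Finite.mem_toFinset _).1 hg).2
  · intro g hg
    by_contra hne
    have h2 : g ∈ {g : G | t g = x} := Set.mem_of_indicator_ne_zero hne
    refine hg ((Set.Finite.mem_toFinset _).2 ⟨hφ g fun h0 => hne ?_, h2⟩)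
    rw [Set.indicator_apply, h0, ite_self]

lemma norm_tsum_fibre_le (t : G → X) {S : Set G} {x : X} {N : ℕ}
    (hN : {g | g ∈ S ∧ t g = x}.encard ≤ N) {φ : G → ℂ} (hφ : ∀ g, φ g ≠ 0 → g ∈ S) {C : ℝ}
    (hC0 : 0 ≤ C) (hC : ∀ g, ‖φ g‖ ≤ C) : ‖∑' g : {g : G // t g = x}, φ g‖ ≤ N * C := by
  have hfin := Set.finite_of_encard_le_coe hN
  rw [tsum_fibre_eq_sum t hfin hφ]
  have hcard : hfin.toFinset.card ≤ N := by
    rw [hfin.encard_eq_coe_toFinset_card] at hN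
    exact_mod_cast hN
  calc _ ≤ ∑ g ∈ hfin.toFinset, ‖φ g‖ := norm_sum_le _ _
    _ ≤ hfin.toFinset.card • C := Finset.sum_le_card_nsmul _ _ _ fun g _ => hC g
    _ ≤ N * C := by
      rw [nsmul_eq_mul]
      gcongr

/-- If `t` is injective on `S`, the number of points of `S` over `x` is the characteristic function
of `t(S)`. -/
lemma tsum_fibre_indicator (t : G → X) {S : Set G} (ht : Set.InjOn t S) (x : X) :
    ∑' g : {g : G // t g = x}, S.indicator (1 : G → ℂ) g = (t '' S).indicator 1 x := by
  by_cases hx : x ∈ t '' S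
  · rw [Set.indicator_of_mem hx]
    obtain ⟨g, hg, rfl⟩ := hx
    rw [tsum_eq_single ⟨g, rfl⟩]
    · exact Set.indicator_of_mem hg _
    · rintro ⟨k, hk⟩ hne
      refine Set.indicator_of_notMem (fun hkS => hne ?_) _
      exact Subtype.ext (ht hkS hg hk)
  · rw [Set.indicator_of_notMem hx]
    refine (tsum_congr fun g => ?_).trans tsum_zero
    exact Set.indicator_of_notMem (fun hg => hx ⟨g, hg, g.2⟩) _

/-- The sum over a fibre of a function which vanishes on the part of the fibre outside of a set. -/
lemma tsum_fibre_subtype (t : G → X) (A : Set G) (φ : G → ℂ) (x : X)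
    (hφ : ∀ g, t g = x → g ∉ A → φ g = 0) :
    ∑' g : {g : G // t g = x}, φ g = ∑' g : {g : A // t g = x}, φ g := by
  let e : {g : A // t g = x} → {g : G // t g = x} := fun g => ⟨g.1, g.2⟩
  have he : Function.Injective e := fun a b hab =>
    Subtype.ext (Subtype.ext (congrArg (fun g => g.1) hab))
  refine (he.tsum_eq (f := fun g => φ g) ?_).symm
  intro g hg
  by_contra hne
  refine hg (hφ g g.2 fun hA => hne ⟨⟨⟨g, hA⟩, g.2⟩, rfl⟩)

end FibreSums

namespace RDiscreteGroupoid

variable {X G : Type*} [TopologicalSpace X] [TopologicalSpace G] {𝒢 : RDiscreteGroupoid X G}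

lemma exists_card_le {K : Set G} (hK : IsCompact K) : ∃ N : ℕ,
    (∀ x, {g | g ∈ K ∧ 𝒢.r g = x}.encard ≤ N) ∧ ∀ x, {g | g ∈ K ∧ 𝒢.s g = x}.encard ≤ N := by
  obtain ⟨N₁, h₁⟩ := 𝒢.exists_card_r_le hK
  obtain ⟨N₂, h₂⟩ := 𝒢.exists_card_r_le (hK.image 𝒢.continuous_inv)
  refine ⟨max N₁ N₂, fun x => (h₁ x).trans (by exact_mod_cast le_max_left _ _), fun x => ?_⟩
  refine (Set.encard_le_encard_of_injOn (f := 𝒢.inv) ?_ ?_).trans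
    ((h₂ x).trans (by exact_mod_cast le_max_right _ _))
  · rintro g ⟨hg, rfl⟩
    exact ⟨⟨g, hg, rfl⟩, 𝒢.r_inv g⟩
  · exact 𝒢.invHomeomorph.injective.injOn

lemma IsCantor.continuous_tsum_s (hG : 𝒢.IsCantor) (f : C_c(G, ℂ)) :
    Continuous fun x : X => ∑' g : {g : G // 𝒢.s g = x}, f g := by
  refine (hG.countingIsHaar (star (𝒢.involution f))).congr fun x => ?_
  refine ((𝒢.invFibreEquiv x).tsum_eq fun k => star (𝒢.involution f) k).symm.trans
    (tsum_congr fun k => ?_)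
  change star (star (f (𝒢.inv (𝒢.inv k)))) = _
  rw [star_star, 𝒢.inv_inv]

lemma extendZero_apply (H : 𝒢.WideSubgroupoid) (hG : T2Space G) (hH : IsOpen H.carrier)
    (f : C_c(H.carrier, ℂ)) (g : H.carrier) : H.extendZero hG hH f g = f g :=
  Subtype.val_injective.extend_apply f 0 g

lemma extendZero_of_notMem (H : 𝒢.WideSubgroupoid) (hG : T2Space G) (hH : IsOpen H.carrier)
    (f : C_c(H.carrier, ℂ)) {g : G} (hg : g ∉ H.carrier) : H.extendZero hG hH f g = 0 :=
  Function.extend_apply' (f := Subtype.val) f 0 g fun ⟨k, hk⟩ => hg (hk ▸ k.2)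

variable [MeasurableSpace X]

lemma isInvariant_toGroupoid (H : 𝒢.WideSubgroupoid) (hG : T2Space G) (hH : IsOpen H.carrier)
    (μ : Measure X) (hμ : 𝒢.IsInvariant μ) : H.toGroupoid.IsInvariant μ := by
  intro f
  have h := hμ (H.extendZero hG hH f)
  have key : ∀ (t : G → X) (x : X), ∑' g : {g : G // t g = x}, H.extendZero hG hH f g =
      ∑' g : {g : H.carrier // t g = x}, f g := by
    intro t x
    rw [tsum_fibre_subtype t H.carrier _ x fun g _ hg => extendZero_of_notMem H hG hH f hg]
    exact tsum_congr fun g => extendZero_apply H hG hH f g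
  simp only [key] at h
  exact h

/-! ### Invariance of a measure beyond continuous functions -/

variable [BorelSpace X]

/-- The defining equation of an invariant measure passes to pointwise limits of uniformly bounded
sequences in `C_c(G)` which live on a set whose intersections with the fibres of the range and
source maps have bounded cardinality. -/
lemma IsCantor.integral_tsum_eq_of_tendsto (hG : 𝒢.IsCantor) (μ : Measure X) [IsFiniteMeasure μ]
    (hμ : 𝒢.IsInvariant μ) {S : Set G} {N : ℕ} (hr : ∀ x, {g | g ∈ S ∧ 𝒢.r g = x}.encard ≤ N)
    (hs : ∀ x, {g | g ∈ S ∧ 𝒢.s g = x}.encard ≤ N) (f : ℕ → C_c(G, ℂ)) (F : G → ℂ)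
    (hfS : ∀ n g, f n g ≠ 0 → g ∈ S) {C : ℝ} (hC0 : 0 ≤ C) (hC : ∀ n g, ‖f n g‖ ≤ C)
    (hlim : ∀ g, Filter.Tendsto (fun n => f n g) Filter.atTop (nhds (F g))) :
    ∫ x, (∑' g : {g : G // 𝒢.r g = x}, F g) ∂μ = ∫ x, (∑' g : {g : G // 𝒢.s g = x}, F g) ∂μ := by
  have hFS : ∀ g, F g ≠ 0 → g ∈ S := by
    intro g hg
    obtain ⟨n, hn⟩ := ((hlim g).eventually_ne hg).exists
    exact hfS n g hn
  have key : ∀ t : G → X, (∀ x, {g | g ∈ S ∧ t g = x}.encard ≤ N) →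
      (∀ n, Continuous fun x => ∑' g : {g : G // t g = x}, f n g) →
      Filter.Tendsto (fun n => ∫ x, (∑' g : {g : G // t g = x}, f n g) ∂μ) Filter.atTop
        (nhds (∫ x, (∑' g : {g : G // t g = x}, F g) ∂μ)) := by
    intro t ht hc
    refine tendsto_integral_of_dominated_convergence (fun _ => N * C)
      (fun n => (hG.integrable_of_continuous μ (hc n)).aestronglyMeasurable)
      (integrable_const _)
      (fun n => .of_forall fun x => norm_tsum_fibre_le t (ht x) (hfS n) hC0 (hC n))
      (.of_forall fun x => ?_)
    have hfin := Set.finite_of_encard_le_coe (ht x)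
    rw [tsum_fibre_eq_sum t hfin hFS]
    simp only [fun n => tsum_fibre_eq_sum t hfin (hfS n)]
    exact tendsto_finsetSum _ fun g _ => hlim g
  have h1 := key 𝒢.r hr fun n => hG.countingIsHaar (f n)
  have h2 := key 𝒢.s hs fun n => hG.continuous_tsum_s (f n)
  simp only [hμ (f _)] at h1
  exact tendsto_nhds_unique h1 h2

/-- The source and the range of a compact `G`-set `S` have the same measure: the characteristic
function of `S` is the limit of the powers of a bump function. -/
lemma IsCantor.measure_range_eq (hG : 𝒢.IsCantor) (μ : Measure X) [IsFiniteMeasure μ]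
    (hμ : 𝒢.IsInvariant μ) {S : Set G} (hS : IsCompact S) (hS' : 𝒢.IsGSet S) :
    μ (𝒢.r '' S) = μ (𝒢.s '' S) := by
  have := hG.t2Space
  have := hG.t2Space_unit
  have := hG.locallyCompactSpace
  have := hG.secondCountableTopology
  have hmet := TopologicalSpace.metrizableSpace_of_t3_secondCountable G
  let := TopologicalSpace.metrizableSpaceMetric G
  obtain ⟨φ, hφS, -, hφc, hφ⟩ := exists_continuous_one_zero_of_isCompact_of_isGδ
    hS hS.isClosed.isGδ isClosed_empty (Set.disjoint_empty _)
  obtain ⟨N, hr, hs⟩ := 𝒢.exists_card_le hφc.isCompact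
  let f : ℕ → C_c(G, ℂ) := fun n => complexify (φ ^ (n + 1))
    (hφc.comp_left (g := fun y : ℝ => y ^ (n + 1)) (by simp))
  have hf : ∀ n g, f n g = ((φ g ^ (n + 1) : ℝ) : ℂ) := fun n g => rfl
  have h := hG.integral_tsum_eq_of_tendsto μ hμ hr hs f (S.indicator 1) (C := 1) ?_ zero_le_one
    ?_ ?_
  · simp only [tsum_fibre_indicator 𝒢.r hS'.1, tsum_fibre_indicator 𝒢.s hS'.2] at h
    rw [integral_indicator (hS.image 𝒢.continuous_r).isClosed.measurableSet,
      integral_indicator (hS.image 𝒢.continuous_s).isClosed.measurableSet] at h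
    simp only [Pi.one_apply, integral_const, measureReal_restrict_apply_univ, Complex.real_smul,
      mul_one] at h
    have h' : μ.real (𝒢.r '' S) = μ.real (𝒢.s '' S) := by exact_mod_cast h
    exact (measureReal_eq_measureReal_iff).1 h'
  · intro n g hg
    refine subset_tsupport _ fun h0 => hg ?_
    rw [hf, h0]
    simp
  · intro n g
    rw [hf, Complex.norm_real, norm_pow, Real.norm_of_nonneg (hφ g).1]
    exact pow_le_one₀ (hφ g).1 (hφ g).2
  · intro g
    simp only [hf]
    by_cases hg : g ∈ S
    · have h1 : φ g = 1 := by
        rw [hφS] at hg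
        exact hg
      rw [Set.indicator_of_mem hg]
      simp [h1]
    · rw [Set.indicator_of_notMem hg]
      have h1 : φ g < 1 := lt_of_le_of_ne (hφ g).2 fun h => hg (by rw [hφS]; exact h)
      have h2 := (tendsto_pow_atTop_nhds_zero_of_lt_one (hφ g).1 h1).comp
        (Filter.tendsto_add_atTop_nat 1)
      exact_mod_cast (Complex.continuous_ofReal.tendsto 0).comp h2

/-- Thin sets are null sets for every invariant probability measure: there are `n` disjoint sets of
the same measure, for all `n`. -/
lemma IsCantor.measure_eq_zero_of_isThin (hG : 𝒢.IsCantor) (μ : Measure X) [IsProbabilityMeasure μ]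
    (hμ : 𝒢.IsInvariant μ) {K : Set X} (hK : 𝒢.IsThin K) : μ K = 0 := by
  have := hG.t2Space_unit
  have h : ∀ n : ℕ, n * μ K ≤ 1 := by
    intro n
    obtain ⟨S, hS, hd⟩ := hK.2 n
    have h1 : μ (⋃ k, 𝒢.r '' S k) = n * μ K := by
      rw [measure_iUnion hd fun k => ((hS k).1.image 𝒢.continuous_r).isClosed.measurableSet,
        tsum_fintype]
      simp only [fun k => hG.measure_range_eq μ hμ (hS k).1 (hS k).2.1, (hS _).2.2]
      simp
    rw [← h1]
    exact prob_le_one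
  by_contra hne
  obtain ⟨n, hn⟩ := ENNReal.exists_nat_mul_gt hne ENNReal.one_ne_top
  exact absurd (h n) (not_le.2 hn)

/-- If `s(K)` is thin in the open AF subgroupoid `H` for every compact set `K` outside of `H`, then
every `H`-invariant measure is `G`-invariant. For `f ∈ C_c(G)`, the arrows of the support of `f`
outside of `H` lie over null sets, and the restriction of `f` to `H` is the limit of its restrictions
to the compact open subgroupoids which exhaust `H`. -/
lemma isInvariant_of_toGroupoid (H : 𝒢.WideSubgroupoid) (hG : 𝒢.IsCantor) (hH : IsOpen H.carrier)
    (hAF : H.toGroupoid.IsAF)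
    (hthin : ∀ K : Set G, IsCompact K → K ⊆ H.carrierᶜ → H.toGroupoid.IsThin (𝒢.s '' K))
    (μ : Measure X) [IsProbabilityMeasure μ] (hμ : H.toGroupoid.IsInvariant μ) :
    𝒢.IsInvariant μ := by
  obtain ⟨hH', L, hL, hmono, hunion⟩ := hAF
  have hT2 := hG.t2Space
  have hT2' := hH'.t2Space
  intro f
  have hLcl : ∀ n, IsClopen (L n).carrier := fun n => ⟨(hL n).1.isClosed, (hL n).2.1⟩
  set K : Set G := tsupport f ∩ H.carrierᶜ
  have hK : IsCompact K := f.hasCompactSupport.isCompact.inter_right hH.isClosed_compl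
  -- the arrows outside of `H` lie over null sets, both for the source and for the range map
  have hs0 : μ (𝒢.s '' K) = 0 :=
    hH'.measure_eq_zero_of_isThin μ hμ (hthin K hK Set.inter_subset_right)
  have hr0 : μ (𝒢.r '' K) = 0 := by
    have h1 : 𝒢.r '' K = 𝒢.s '' (𝒢.inv '' K) := by
      rw [Set.image_image]
      simp only [𝒢.s_inv]
    rw [h1]
    refine hH'.measure_eq_zero_of_isThin μ hμ (hthin _ (hK.image 𝒢.continuous_inv) ?_)
    rintro _ ⟨g, hg, rfl⟩ hg'
    refine hg.2 ?_
    rw [← 𝒢.inv_inv g]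
    exact H.inv_mem _ hg'
  obtain ⟨N, hr, hs⟩ := 𝒢.exists_card_le f.hasCompactSupport.isCompact
  obtain ⟨C, hC⟩ := f.hasCompactSupport.exists_bound_of_continuous f.continuous
  have hcard : ∀ t : G → X, (∀ x, {g | g ∈ tsupport f ∧ t g = x}.encard ≤ N) → ∀ x,
      {g : H.carrier | g.1 ∈ tsupport f ∧ t g.1 = x}.encard ≤ N := by
    intro t ht x
    refine (Set.encard_le_encard_of_injOn (f := Subtype.val) ?_ Subtype.val_injective.injOn).trans
      (ht x)
    exact fun g hg => hg
  -- the restrictions of `f` to the compact open subgroupoids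
  let F : ℕ → C_c(H.carrier, ℂ) := fun n =>
    ⟨⟨(L n).carrier.indicator fun g => f g,
      (hLcl n).continuous_indicator (f.continuous.comp continuous_subtype_val)⟩,
      HasCompactSupport.intro (hL n).1 fun g hg =>
        Set.indicator_of_notMem hg fun g : H.carrier => f g⟩
  have hF : ∀ n g, F n g = (L n).carrier.indicator (fun g => f g) g := fun n g => rfl
  have key := hH'.integral_tsum_eq_of_tendsto μ hμ (S := {g : H.carrier | g.1 ∈ tsupport f})
    (hcard 𝒢.r hr) (hcard 𝒢.s hs) F (fun g => f g) ?_ (le_max_right C 0) ?_ ?_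
  · have hae : ∀ t : G → X, μ (t '' K) = 0 →
        ∫ x, (∑' g : {g : G // t g = x}, f g) ∂μ =
          ∫ x, (∑' g : {g : H.carrier // t g = x}, f g) ∂μ := by
      intro t ht
      refine integral_congr_ae ?_
      filter_upwards [measure_eq_zero_iff_ae_notMem.1 ht] with x hx
      refine tsum_fibre_subtype t H.carrier f x fun g hg hgH => ?_
      by_contra hne
      exact hx ⟨g, ⟨subset_tsupport _ hne, hgH⟩, hg⟩
    rw [hae 𝒢.r hr0, hae 𝒢.s hs0]
    exact key
  · intro n g hg
    rw [hF] at hg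
    have hgL : g ∈ (L n).carrier := Set.mem_of_indicator_ne_zero hg
    rw [Set.indicator_of_mem hgL] at hg
    exact subset_tsupport _ hg
  · intro n g
    rw [hF]
    exact (norm_indicator_le_norm_self _ _).trans ((hC g).trans (le_max_left _ _))
  · intro g
    obtain ⟨n, hn⟩ := Set.mem_iUnion.1 (hunion.symm ▸ Set.mem_univ g)
    refine tendsto_const_nhds.congr' ?_
    filter_upwards [Filter.eventually_ge_atTop n] with m hm
    rw [hF, Set.indicator_of_mem (monotone_nat_of_le_succ hmono hm hn)]

end RDiscreteGroupoid

/-! ### The inclusion of reduced C*-algebras -/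

lemma hasSum_norm_sq_lp {ι : Type*} (ξ : ℓ²(ι, ℂ)) : HasSum (fun i => ‖ξ i‖ ^ 2) (‖ξ‖ ^ 2) := by
  simpa using lp.hasSum_norm (p := 2) (by norm_num) ξ

namespace RDiscreteGroupoid

variable {X G : Type*} [TopologicalSpace X] [TopologicalSpace G] {𝒢 : RDiscreteGroupoid X G}
  (H : 𝒢.WideSubgroupoid)

namespace WideSubgroupoid

/-- Right multiplication by `c`, from the arrows of the subgroupoid `H` starting at `r(c)` to the
coset `H c`. -/
def mulRight (c : G) (d : {d : H.carrier // 𝒢.s d = 𝒢.r c}) : G := 𝒢.mul d.1 c d.2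

lemma mulRight_injective (c : G) : Function.Injective (H.mulRight c) := fun a b hab =>
  Subtype.ext (Subtype.ext (𝒢.mul_right_cancel a.2 b.2 hab))

open Classical in
/-- The function `d ↦ ξ(d c)` on the arrows of `H` starting at `r(c)`, extended by zero to `H`. -/
noncomputable def sliceFun (c : G) (ξ : G → ℂ) (d : H.carrier) : ℂ :=
  if e : 𝒢.s d = 𝒢.r c then ξ (𝒢.mul d c e) else 0

lemma sliceFun_of_eq (c : G) (ξ : G → ℂ) {d : H.carrier} (e : 𝒢.s d = 𝒢.r c) :
    H.sliceFun c ξ d = ξ (𝒢.mul d c e) := dif_pos e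

lemma sliceFun_of_ne (c : G) (ξ : G → ℂ) {d : H.carrier} (e : 𝒢.s d ≠ 𝒢.r c) :
    H.sliceFun c ξ d = 0 := dif_neg e

lemma hasSum_sliceFun_iff (c : G) (ξ : G → ℂ) (m : ℝ) :
    HasSum (fun d => ‖H.sliceFun c ξ d‖ ^ 2) m ↔ HasSum (fun d => ‖ξ (H.mulRight c d)‖ ^ 2) m := by
  have h : Function.support (fun d => ‖H.sliceFun c ξ d‖ ^ 2) ⊆ {d | 𝒢.s d = 𝒢.r c} := by
    intro d hd
    by_contra hne
    refine hd ?_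
    change ‖H.sliceFun c ξ d‖ ^ 2 = 0
    rw [H.sliceFun_of_ne c ξ hne, norm_zero, zero_pow two_ne_zero]
  rw [← hasSum_subtype_iff_of_support_subset h]
  have e : ((fun d => ‖H.sliceFun c ξ d‖ ^ 2) ∘ Subtype.val :
      {d : H.carrier | 𝒢.s d = 𝒢.r c} → ℝ) = fun d => ‖ξ (H.mulRight c d)‖ ^ 2 := by
    funext d
    have hd : 𝒢.s d.1 = 𝒢.r c := d.2
    change ‖H.sliceFun c ξ d.1‖ ^ 2 = _
    rw [H.sliceFun_of_eq c ξ hd]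
    rfl
  rw [e]
  rfl

lemma memℓp_sliceFun (c : G) (ξ : ℓ²(G, ℂ)) : Memℓp (H.sliceFun c ξ) 2 := by
  have h := (hasSum_norm_sq_lp ξ).summable.comp_injective (H.mulRight_injective c)
  obtain ⟨m, hm⟩ := h
  refine memℓp_gen ?_
  simpa using ((H.hasSum_sliceFun_iff c ξ m).2 hm).summable

/-- The restriction of functions on `G` to the coset `H c`, as a linear map `ℓ²(G) → ℓ²(H)`. -/
noncomputable def sliceLinear (c : G) : ℓ²(G, ℂ) →ₗ[ℂ] ℓ²(H.carrier, ℂ) where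
  toFun ξ := ⟨H.sliceFun c ξ, H.memℓp_sliceFun c ξ⟩
  map_add' ξ η := by
    refine lp.ext (funext fun d => ?_)
    change H.sliceFun c (ξ + η : ℓ²(G, ℂ)) d = H.sliceFun c ξ d + H.sliceFun c η d
    by_cases e : 𝒢.s d = 𝒢.r c
    · simp only [H.sliceFun_of_eq c _ e, lp.coeFn_add, Pi.add_apply]
    · simp only [H.sliceFun_of_ne c _ e, add_zero]
  map_smul' z ξ := by
    refine lp.ext (funext fun d => ?_)
    change H.sliceFun c (z • ξ : ℓ²(G, ℂ)) d = z • H.sliceFun c ξ d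
    by_cases e : 𝒢.s d = 𝒢.r c
    · simp only [H.sliceFun_of_eq c _ e, lp.coeFn_smul, Pi.smul_apply]
    · simp only [H.sliceFun_of_ne c _ e, smul_zero]

lemma hasSum_norm_sliceLinear (c : G) (ξ : ℓ²(G, ℂ)) :
    HasSum (fun d => ‖ξ (H.mulRight c d)‖ ^ 2) (‖H.sliceLinear c ξ‖ ^ 2) :=
  (H.hasSum_sliceFun_iff c ξ _).1 (hasSum_norm_sq_lp (H.sliceLinear c ξ))

lemma norm_sliceLinear_le (c : G) (ξ : ℓ²(G, ℂ)) : ‖H.sliceLinear c ξ‖ ≤ 1 * ‖ξ‖ := by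
  rw [one_mul]
  refine (sq_le_sq₀ (norm_nonneg _) (norm_nonneg _)).1 ?_
  exact hasSum_le_inj (H.mulRight c) (H.mulRight_injective c) (fun _ _ => by positivity)
    (fun _ => le_rfl) (H.hasSum_norm_sliceLinear c ξ) (hasSum_norm_sq_lp ξ)

/-- The operator `ℓ²(G) → ℓ²(H)` which restricts a function to the coset `H c`, identified with the
arrows of `H` starting at `r(c)`. -/
noncomputable def slice (c : G) : ℓ²(G, ℂ) →L[ℂ] ℓ²(H.carrier, ℂ) :=
  (H.sliceLinear c).mkContinuous 1 (H.norm_sliceLinear_le c)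

lemma slice_apply (c : G) (ξ : ℓ²(G, ℂ)) (d : H.carrier) : H.slice c ξ d = H.sliceFun c ξ d := rfl

/-- Two arrows are equivalent if they are in the same coset `H c`. -/
def cosetSetoid : Setoid G where
  r c k := ∃ d : {d : H.carrier // 𝒢.s d = 𝒢.r c}, H.mulRight c d = k
  iseqv :=
    { refl := fun c => ⟨⟨⟨𝒢.unit (𝒢.r c), H.unit_mem _⟩, 𝒢.s_unit _⟩, 𝒢.unit_mul c⟩
      symm := by
        rintro c _ ⟨d, rfl⟩
        refine ⟨⟨⟨𝒢.inv d.1, H.inv_mem _ d.1.2⟩, ?_⟩, ?_⟩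
        · exact (𝒢.s_inv _).trans (𝒢.r_mul _ _ _).symm
        · change 𝒢.mul (𝒢.inv d.1) (𝒢.mul d.1 c d.2) _ = c
          rw [← 𝒢.mul_assoc _ _ _ (𝒢.s_inv _) d.2]
          refine Eq.trans ?_ (𝒢.unit_mul c)
          exact 𝒢.mul_congr _ _ ((𝒢.inv_mul _).trans (by rw [d.2])) rfl
      trans := by
        rintro c _ _ ⟨d, rfl⟩ ⟨d', rfl⟩
        have e : 𝒢.s d'.1 = 𝒢.r d.1 := d'.2.trans (𝒢.r_mul _ _ _)
        refine ⟨⟨⟨𝒢.mul d'.1 d.1 e, H.mul_mem _ d'.1.2 _ d.1.2 e⟩, ?_⟩, ?_⟩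
        · exact (𝒢.s_mul _ _ _).trans d.2
        · exact 𝒢.mul_assoc _ _ _ e d.2 }

/-- Parseval's identity for the decomposition of `G` into the cosets of `H`. -/
lemma hasSum_norm_slice (ξ : ℓ²(G, ℂ)) :
    HasSum (fun q : Quotient H.cosetSetoid => ‖H.slice q.out ξ‖ ^ 2) (‖ξ‖ ^ 2) := by
  let e : (Σ q : Quotient H.cosetSetoid, {d : H.carrier // 𝒢.s d = 𝒢.r q.out}) → G :=
    fun p => H.mulRight p.1.out p.2
  have hq : ∀ p, (Quotient.mk H.cosetSetoid (e p)) = p.1 := fun p =>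
    ((Quotient.sound (s := H.cosetSetoid) ⟨p.2, rfl⟩).symm).trans (Quotient.out_eq p.1)
  have he : Function.Bijective e := by
    constructor
    · rintro ⟨q, d⟩ ⟨q', d'⟩ h
      have h1 : q = q' := by
        have h2 := hq ⟨q, d⟩
        rw [h, hq] at h2
        exact h2.symm
      subst h1
      exact congrArg (Sigma.mk q) (H.mulRight_injective _ h)
    · intro k
      obtain ⟨d, hd⟩ := Quotient.exact (s := H.cosetSetoid)
        (Quotient.out_eq (Quotient.mk H.cosetSetoid k))
      exact ⟨⟨_, d⟩, hd⟩
  have h := (Equiv.ofBijective e he).hasSum_iff.2 (hasSum_norm_sq_lp ξ)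
  exact h.sigma fun q => H.hasSum_norm_sliceLinear q.out ξ

/-- The operators `a` on `ℓ²(H)` and `b` on `ℓ²(G)` (and their adjoints) are intertwined by the
restrictions to the cosets of `H`; that is, `b` acts on functions on the coset `H c` as `a` acts on
functions on the arrows of `H` starting at `r(c)`. -/
structure Intertwines (a : ℓ²(H.carrier, ℂ) →L[ℂ] ℓ²(H.carrier, ℂ))
    (b : ℓ²(G, ℂ) →L[ℂ] ℓ²(G, ℂ)) : Prop where
  slice_eq : ∀ c ξ, a (H.slice c ξ) = H.slice c (b ξ)
  star_slice_eq : ∀ c ξ, (star a) (H.slice c ξ) = H.slice c (star b ξ)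

namespace Intertwines

variable {H} {a a' : ℓ²(H.carrier, ℂ) →L[ℂ] ℓ²(H.carrier, ℂ)} {b b' : ℓ²(G, ℂ) →L[ℂ] ℓ²(G, ℂ)}

lemma star (h : H.Intertwines a b) : H.Intertwines (star a) (star b) :=
  ⟨h.star_slice_eq, fun c ξ => by rw [star_star, star_star, h.slice_eq]⟩

lemma add (h : H.Intertwines a b) (h' : H.Intertwines a' b') :
    H.Intertwines (a + a') (b + b') :=
  ⟨fun c ξ => by simp [h.slice_eq, h'.slice_eq],
    fun c ξ => by simp [h.star_slice_eq, h'.star_slice_eq]⟩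

lemma sub (h : H.Intertwines a b) (h' : H.Intertwines a' b') :
    H.Intertwines (a - a') (b - b') :=
  ⟨fun c ξ => by simp [h.slice_eq, h'.slice_eq],
    fun c ξ => by simp [h.star_slice_eq, h'.star_slice_eq]⟩

lemma mul (h : H.Intertwines a b) (h' : H.Intertwines a' b') :
    H.Intertwines (a * a') (b * b') :=
  ⟨fun c ξ => by simp [mul_apply_eq_comp, h.slice_eq, h'.slice_eq],
    fun c ξ => by simp [mul_apply_eq_comp, h.star_slice_eq, h'.star_slice_eq]⟩

lemma algebraMap (z : ℂ) : H.Intertwines (algebraMap ℂ _ z) (algebraMap ℂ _ z) :=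
  ⟨fun c ξ => by simp [Algebra.algebraMap_eq_smul_one],
    fun c ξ => by simp [Algebra.algebraMap_eq_smul_one]⟩

lemma norm_le (h : H.Intertwines a b) : ‖b‖ ≤ ‖a‖ := by
  refine b.opNorm_le_bound (norm_nonneg _) fun ξ => ?_
  refine abs_le_of_sq_le_sq' ?_ (by positivity) |>.2
  rw [mul_pow]
  refine hasSum_le (fun q => ?_) (H.hasSum_norm_slice (b ξ))
    ((H.hasSum_norm_slice ξ).mul_left (‖a‖ ^ 2))
  rw [← h.slice_eq, ← mul_pow]
  gcongr
  exact a.le_opNorm _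

lemma right_unique (h : H.Intertwines a b) (h' : H.Intertwines a b') : b = b' := by
  have := (h.sub h').norm_le
  rw [sub_self, norm_zero] at this
  exact sub_eq_zero.1 (norm_le_zero_iff.1 this)

/-- The coset of the unit at `s(d)` contains `d`, so that `a δ_d` is determined by `b`. -/
lemma eq_zero (h : H.Intertwines a 0) : a = 0 := by
  refine clm_ext_deltaVec fun d => ?_
  have h1 : H.slice (𝒢.unit (𝒢.s d)) (deltaVec (d : G)) = deltaVec d := by
    refine lp.ext (funext fun k => ?_)
    rw [slice_apply, deltaVec_apply]
    by_cases e : 𝒢.s k = 𝒢.r (𝒢.unit (𝒢.s d))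
    · have e' : 𝒢.s k = 𝒢.s d := e.trans (𝒢.r_unit _)
      have h2 : 𝒢.mul k (𝒢.unit (𝒢.s d)) e = k :=
        (𝒢.mul_congr _ (𝒢.r_unit _).symm rfl (by rw [e'])).trans (𝒢.mul_unit k)
      rw [H.sliceFun_of_eq _ _ e, h2, deltaVec_apply]
      by_cases hkd : k = d
      · rw [if_pos hkd, if_pos (congrArg Subtype.val hkd)]
      · rw [if_neg hkd, if_neg fun h3 => hkd (Subtype.ext h3)]
    · rw [H.sliceFun_of_ne _ _ e, if_neg]
      rintro rfl
      exact e (𝒢.r_unit _).symm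
  rw [← h1, h.slice_eq]
  simp

end Intertwines

lemma isClosed_intertwines :
    IsClosed {p : (ℓ²(H.carrier, ℂ) →L[ℂ] ℓ²(H.carrier, ℂ)) × (ℓ²(G, ℂ) →L[ℂ] ℓ²(G, ℂ)) |
      H.Intertwines p.1 p.2} := by
  have h1 : Continuous fun p : (ℓ²(H.carrier, ℂ) →L[ℂ] ℓ²(H.carrier, ℂ)) ×
      (ℓ²(G, ℂ) →L[ℂ] ℓ²(G, ℂ)) => star p.1 := continuous_star.comp continuous_fst
  have h2 : Continuous fun p : (ℓ²(H.carrier, ℂ) →L[ℂ] ℓ²(H.carrier, ℂ)) ×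
      (ℓ²(G, ℂ) →L[ℂ] ℓ²(G, ℂ)) => star p.2 := continuous_star.comp continuous_snd
  have h : IsClosed {p : (ℓ²(H.carrier, ℂ) →L[ℂ] ℓ²(H.carrier, ℂ)) ×
      (ℓ²(G, ℂ) →L[ℂ] ℓ²(G, ℂ)) | ∀ c ξ, p.1 (H.slice c ξ) = H.slice c (p.2 ξ) ∧
        (star p.1) (H.slice c ξ) = H.slice c (star p.2 ξ)} := by
    simp only [Set.ofPred_forall, Set.ofPred_and]
    refine isClosed_iInter fun c => isClosed_iInter fun ξ => IsClosed.inter ?_ ?_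
    · exact isClosed_eq (continuous_fst.clm_apply continuous_const)
        ((H.slice c).continuous.comp (continuous_snd.clm_apply continuous_const))
    · exact isClosed_eq (h1.clm_apply continuous_const)
        ((H.slice c).continuous.comp (h2.clm_apply continuous_const))
  convert h using 3 with p
  exact ⟨fun h c ξ => ⟨h.slice_eq c ξ, h.star_slice_eq c ξ⟩,
    fun h => ⟨fun c ξ => (h c ξ).1, fun c ξ => (h c ξ).2⟩⟩

lemma involution_extendZero (hG : T2Space G) (hH : IsOpen H.carrier) (f : C_c(H.carrier, ℂ)) :
    𝒢.involution (H.extendZero hG hH f) = H.extendZero hG hH (H.toGroupoid.involution f) := by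
  ext g
  rw [involution_apply]
  by_cases hg : g ∈ H.carrier
  · have h1 := extendZero_apply H hG hH f ⟨𝒢.inv g, H.inv_mem g hg⟩
    have h2 := extendZero_apply H hG hH (H.toGroupoid.involution f) ⟨g, hg⟩
    simp only at h1 h2
    rw [h1, h2]
    rfl
  · rw [extendZero_of_notMem H hG hH _ hg, extendZero_of_notMem H hG hH, star_zero]
    intro h
    refine hg ?_
    rw [← 𝒢.inv_inv g]
    exact H.inv_mem _ h

/-- For `f ∈ C_c(H)`, the matrix entry of `λ(f)` at `(d c, k)` vanishes unless `k = d' c` with `d'` in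
`H`, and then it is `f((d c)(d' c)⁻¹) = f(d d'⁻¹)`. -/
lemma regRep_slice (hG : T2Space G) (hH : IsOpen H.carrier) (f : C_c(H.carrier, ℂ)) (c : G)
    (ξ : ℓ²(G, ℂ)) : H.toGroupoid.regRep f (H.slice c ξ) =
      H.slice c (𝒢.regRep (H.extendZero hG hH f) ξ) := by
  refine lp.ext (funext fun d => ?_)
  rw [slice_apply, regRep_eq_tsum_kernel]
  by_cases e : 𝒢.s d = 𝒢.r c
  · rw [H.sliceFun_of_eq c _ e, regRep_eq_tsum_kernel]
    have h1 : Function.support (fun k => H.toGroupoid.kernel f d k * H.slice c ξ k) ⊆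
        {k | 𝒢.s k = 𝒢.r c} := by
      intro k hk
      by_contra hne
      exact hk (mul_eq_zero_of_right _ (H.sliceFun_of_ne c ξ hne))
    rw [← tsum_subtype_eq_of_support_subset h1, ← (H.mulRight_injective c).tsum_eq]
    · refine tsum_congr fun k => ?_
      have hk : 𝒢.s k.1 = 𝒢.r c := k.2
      have h2 : H.toGroupoid.s d = H.toGroupoid.s k.1 := e.trans hk.symm
      have h3 : 𝒢.s (𝒢.mul d c e) = 𝒢.s (H.mulRight c k) :=
        (𝒢.s_mul _ _ _).trans (𝒢.s_mul _ _ _).symm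
      have h4 : 𝒢.div (𝒢.mul d c e) (H.mulRight c k) h3 = (H.toGroupoid.div d k.1 h2 : H.carrier) :=
        𝒢.mul_div_mul d k.1 c h2 e hk
      rw [H.toGroupoid.kernel_of_eq f h2, 𝒢.kernel_of_eq _ h3, h4, extendZero_apply, slice_apply,
        H.sliceFun_of_eq c _ hk]
      rfl
    · intro k hk
      have hk1 := left_ne_zero_of_mul hk
      have hs : 𝒢.s (𝒢.mul d c e) = 𝒢.s k := by
        by_contra hne
        exact hk1 (𝒢.kernel_of_ne _ hne)
      rw [𝒢.kernel_of_eq _ hs] at hk1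
      have hmem : 𝒢.div (𝒢.mul d c e) k hs ∈ H.carrier := by
        by_contra hne
        exact hk1 (extendZero_of_notMem H hG hH f hne)
      -- `k = (d c k⁻¹)⁻¹ d c` is in the coset `H c`
      have hc : H.cosetSetoid c (𝒢.mul d c e) := ⟨⟨d, e⟩, rfl⟩
      have hk' : H.cosetSetoid k (𝒢.mul d c e) :=
        ⟨⟨⟨_, hmem⟩, 𝒢.s_div _ _ hs⟩, 𝒢.div_mul_cancel _ _ hs⟩
      exact H.cosetSetoid.trans hc (H.cosetSetoid.symm hk')
  · rw [H.sliceFun_of_ne c _ e]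
    refine (tsum_congr fun k => ?_).trans tsum_zero
    by_cases h : 𝒢.s d = 𝒢.s k
    · rw [slice_apply, H.sliceFun_of_ne c _ (h ▸ e), mul_zero]
    · rw [H.toGroupoid.kernel_of_ne f h, zero_mul]

lemma intertwines_regRep (hG : T2Space G) (hH : IsOpen H.carrier) (f : C_c(H.carrier, ℂ)) :
    H.Intertwines (H.toGroupoid.regRep f) (𝒢.regRep (H.extendZero hG hH f)) :=
  ⟨H.regRep_slice hG hH f, fun c ξ => by
    rw [star_regRep, star_regRep, involution_extendZero, regRep_slice]⟩

/-- The operators on `ℓ²(H)` which are intertwined with an operator in the reduced C*-algebra of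
`G`. -/
noncomputable def intertwinedSubalgebra :
    StarSubalgebra ℂ (ℓ²(H.carrier, ℂ) →L[ℂ] ℓ²(H.carrier, ℂ)) where
  carrier := {a | ∃ b ∈ 𝒢.reducedCStar, H.Intertwines a b}
  mul_mem' := by
    rintro a a' ⟨b, hb, h⟩ ⟨b', hb', h'⟩
    exact ⟨b * b', MulMemClass.mul_mem hb hb', h.mul h'⟩
  add_mem' := by
    rintro a a' ⟨b, hb, h⟩ ⟨b', hb', h'⟩
    exact ⟨b + b', add_mem hb hb', h.add h'⟩
  algebraMap_mem' z := ⟨_, algebraMap_mem _ z, .algebraMap z⟩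
  star_mem' := by
    rintro a ⟨b, hb, h⟩
    exact ⟨star b, star_mem hb, h.star⟩

/-- As intertwined operators satisfy `‖b‖ ≤ ‖a‖`, the partner of a limit is the limit of the
partners. -/
lemma isClosed_intertwinedSubalgebra : IsClosed
    (H.intertwinedSubalgebra : Set (ℓ²(H.carrier, ℂ) →L[ℂ] ℓ²(H.carrier, ℂ))) := by
  refine IsSeqClosed.isClosed fun a a₀ ha hlim => ?_
  choose b hb h using ha
  have hcauchy : CauchySeq b := by
    rw [Metric.cauchySeq_iff]
    intro ε hε
    obtain ⟨N, hN⟩ := Metric.cauchySeq_iff.1 hlim.cauchySeq ε hε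
    refine ⟨N, fun m hm n hn => ?_⟩
    rw [dist_eq_norm]
    refine ((h m).sub (h n)).norm_le.trans_lt ?_
    rw [← dist_eq_norm]
    exact hN m hm n hn
  obtain ⟨b₀, hb₀⟩ := cauchySeq_tendsto_of_complete hcauchy
  exact ⟨b₀, 𝒢.isClosed_reducedCStar.mem_of_tendsto hb₀ (.of_forall hb),
    H.isClosed_intertwines.mem_of_tendsto (hlim.prodMk_nhds hb₀) (.of_forall h)⟩

lemma reducedCStar_le_intertwinedSubalgebra (hG : T2Space G) (hH : IsOpen H.carrier) :
    H.toGroupoid.reducedCStar ≤ H.intertwinedSubalgebra := by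
  refine StarSubalgebra.topologicalClosure_minimal (StarAlgebra.adjoin_le ?_)
    H.isClosed_intertwinedSubalgebra
  rintro _ ⟨f, rfl⟩
  exact ⟨_, (𝒢.toReduced (H.extendZero hG hH f)).2, H.intertwines_regRep hG hH f⟩

/-- The inclusion of the reduced C*-algebra of an open subgroupoid. -/
lemma exists_inclusion (hG : T2Space G) (hH : IsOpen H.carrier) :
    ∃ ι : H.toGroupoid.reducedCStar →⋆ₐ[ℂ] 𝒢.reducedCStar, Function.Injective ι ∧
      ∀ f : C_c(H.carrier, ℂ),
        ι (H.toGroupoid.toReduced f) = 𝒢.toReduced (H.extendZero hG hH f) := by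
  choose φ hφ h using fun a : H.toGroupoid.reducedCStar =>
    H.reducedCStar_le_intertwinedSubalgebra hG hH a.2
  refine ⟨{
    toFun := fun a => ⟨φ a, hφ a⟩
    map_one' := ?_
    map_mul' := fun a a' => Subtype.ext ((h (a * a')).right_unique ((h a).mul (h a')))
    map_zero' := ?_
    map_add' := fun a a' => Subtype.ext ((h (a + a')).right_unique ((h a).add (h a')))
    commutes' := fun z => Subtype.ext ((h _).right_unique (.algebraMap z))
    map_star' := fun a => Subtype.ext ((h (star a)).right_unique (h a).star) }, ?_, ?_⟩
  · exact Subtype.ext ((h 1).right_unique (by simpa using Intertwines.algebraMap (H := H) 1))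
  · exact Subtype.ext ((h 0).right_unique (by simpa using Intertwines.algebraMap (H := H) 0))
  · intro a a' haa'
    have h1 : φ a = φ a' := congrArg Subtype.val haa'
    have h2 := (h a).sub (h a')
    rw [h1, sub_self] at h2
    exact Subtype.ext (sub_eq_zero.1 h2.eq_zero)
  · exact fun f => Subtype.ext ((h _).right_unique (H.intertwines_regRep hG hH f))

end WideSubgroupoid

end RDiscreteGroupoid

/-! ### Traces on the larger groupoid -/

/-- A compact null set in a totally disconnected compact space has clopen neighbourhoods of
arbitrarily small measure. -/
lemma exists_isClopen_measureReal_lt {X : Type*} [TopologicalSpace X] [CompactSpace X] [T2Space X]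
    [TotallyDisconnectedSpace X] [MeasurableSpace X] (μ : Measure X) [IsFiniteMeasure μ]
    [μ.OuterRegular] {K : Set X} (hK : IsCompact K) (hμ : μ K = 0) {ε : ℝ} (hε : 0 < ε) :
    ∃ Y : Set X, IsClopen Y ∧ K ⊆ Y ∧ μ.real Y < ε := by
  obtain ⟨U, hKU, hU, hμU⟩ := K.exists_isOpen_lt_of_lt (μ := μ) (ENNReal.ofReal ε)
    (by rw [hμ]; exact ENNReal.ofReal_pos.2 hε)
  have hex : ∀ x : K, ∃ Y : Set X, IsClopen Y ∧ x.1 ∈ Y ∧ Y ⊆ U := fun x =>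
    compact_exists_isClopen_in_isOpen hU (hKU x.2)
  choose Y hY hxY hYU using hex
  obtain ⟨t, ht⟩ := hK.elim_finite_subcover Y (fun x => (hY x).2)
    fun x hx => Set.mem_iUnion.2 ⟨⟨x, hx⟩, hxY _⟩
  refine ⟨⋃ x ∈ t, Y x, t.finite_toSet.isClopen_biUnion fun x _ => hY x, ht, ?_⟩
  refine (measureReal_mono (Set.iUnion₂_subset fun x _ => hYU x)).trans_lt ?_
  rw [measureReal_def]
  exact (ENNReal.lt_ofReal_iff_toReal_lt (measure_ne_top _ _)).1 hμU

lemma norm_sub_sq_le_of_le {u v : ℂ} {p q m : ℝ} (hu : ‖u‖ ^ 2 ≤ p * m) (hv : ‖v‖ ^ 2 ≤ q * m) :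
    ‖u - v‖ ^ 2 ≤ 2 * (p + q) * m :=
  calc ‖u - v‖ ^ 2 ≤ (‖u‖ + ‖v‖) ^ 2 := by
        gcongr
        exact norm_sub_le u v
    _ ≤ 2 * (‖u‖ ^ 2 + ‖v‖ ^ 2) := add_sq_le
    _ ≤ 2 * (p + q) * m := by linarith

lemma eq_of_forall_norm_sub_sq_le {u v : ℂ} {B : ℝ}
    (h : ∀ ε : ℝ, 0 < ε → ‖u - v‖ ^ 2 ≤ B * ε) : u = v := by
  have h0 : ‖u - v‖ ^ 2 ≤ 0 := by
    refine ge_of_tendsto (x := nhdsWithin 0 (Set.Ioi (0 : ℝ))) (f := fun ε => B * ε) ?_ ?_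
    · have : Filter.Tendsto (fun ε : ℝ => B * ε) (nhds 0) (nhds (B * 0)) :=
        (continuous_const.mul continuous_id).tendsto 0
      rw [mul_zero] at this
      exact this.mono_left nhdsWithin_le_nhds
    · filter_upwards [self_mem_nhdsWithin] with ε hε using h ε hε
  have h1 := pow_eq_zero_iff two_ne_zero |>.1 (le_antisymm h0 (by positivity))
  exact sub_eq_zero.1 (norm_eq_zero.1 h1)

namespace RDiscreteGroupoid

variable {X G : Type*} [TopologicalSpace X] [TopologicalSpace G] {𝒢 : RDiscreteGroupoid X G}

lemma isPrincipal_of_isAF (h : 𝒢.IsAF) : 𝒢.IsPrincipal := by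
  obtain ⟨-, L, hL, -, hunion⟩ := h
  intro g hg
  obtain ⟨n, hn⟩ := Set.mem_iUnion.1 (hunion.symm ▸ Set.mem_univ g)
  exact congrArg Subtype.val ((hL n).2.2.2 ⟨g, hn⟩ hg)

/-- A function on `G` which vanishes outside of a compact subset of an open subgroupoid `H` comes
from `C_c(H)`. -/
lemma exists_extendZero_eq (H : 𝒢.WideSubgroupoid) (hG : T2Space G) (hH : IsOpen H.carrier)
    (f : C_c(G, ℂ)) {K : Set G} (hK : IsCompact K) (hKH : K ⊆ H.carrier)
    (hf : ∀ g, g ∉ K → f g = 0) : ∃ f₀ : C_c(H.carrier, ℂ), H.extendZero hG hH f₀ = f := by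
  have hK' : IsCompact (Subtype.val ⁻¹' K : Set H.carrier) :=
    (Topology.IsInducing.subtypeVal.isCompact_preimage_iff (by rwa [Subtype.range_coe])).2 hK
  refine ⟨⟨⟨fun g => f g, f.continuous.comp continuous_subtype_val⟩,
    HasCompactSupport.intro hK' fun g hg => hf g hg⟩, ?_⟩
  ext g
  by_cases hg : g ∈ H.carrier
  · exact extendZero_apply H hG hH _ ⟨g, hg⟩
  · rw [extendZero_of_notMem H hG hH _ hg, hf g fun h => hg (hKH h)]

lemma IsCantor.exists_extendZero_eq_diag (hG : 𝒢.IsCantor) (H : 𝒢.WideSubgroupoid)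
    (hH : IsOpen H.carrier) (g : C(X, ℂ)) :
    ∃ f₀ : C_c(H.carrier, ℂ), H.extendZero hG.t2Space hH f₀ = hG.diag g := by
  have := hG.compactSpace
  refine exists_extendZero_eq H hG.t2Space hH _ (isCompact_range 𝒢.continuous_unit) ?_
    fun k hk => hG.diag_of_notMem g hk
  rintro _ ⟨x, rfl⟩
  exact H.unit_mem x

/-- For a positive functional `τ` and a clopen set `Y` of units, `|τ(f 1_Y)|² ≤ τ(f f*) τ(1_Y)`. -/
lemma IsCantor.norm_sq_mulCont_le (hG : 𝒢.IsCantor) (τ : 𝒢.reducedCStar →ₗ[ℂ] ℂ)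
    (hτ : ∀ a, 0 ≤ τ (star a * a)) (f : C_c(G, ℂ)) {Y : Set X} (hY : IsClopen Y) :
    ‖τ (𝒢.toReduced (mulCont f (𝒢.pullS (clopenInd hY))))‖ ^ 2 ≤
      ‖τ (𝒢.toReduced f * star (𝒢.toReduced f))‖ *
        ‖τ (𝒢.toReduced (hG.diag (clopenInd hY)))‖ := by
  have h := norm_sq_le_of_nonneg τ hτ (star (𝒢.toReduced f))
    (𝒢.toReduced (hG.diag (clopenInd hY)))
  have h1 : star (clopenInd hY) = clopenInd hY := by
    ext y
    change star (clopenInd hY y) = _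
    by_cases hy : y ∈ Y
    · rw [clopenInd_of_mem hY hy, star_one]
    · rw [clopenInd_of_notMem hY hy, star_zero]
  rwa [star_star, hG.star_toReduced_diag, h1, hG.toReduced_diag_clopenInd_mul_self,
    hG.toReduced_mul_diag] at h

lemma map_toReduced_eq_add (τ : 𝒢.reducedCStar →ₗ[ℂ] ℂ) (f : C_c(G, ℂ)) {Y : Set X}
    (hY : IsClopen Y) : τ (𝒢.toReduced f) =
      τ (𝒢.toReduced (mulCont f (𝒢.pullS (clopenInd hY)))) +
        τ (𝒢.toReduced (mulCont f (𝒢.pullS (clopenInd hY.compl)))) := by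
  have hdec : f = mulCont f (𝒢.pullS (clopenInd hY)) +
      mulCont f (𝒢.pullS (clopenInd hY.compl)) :=
    eq_mulCont_add_mulCont f (hY.preimage 𝒢.continuous_s)
  have h := map_toReduced_add τ (mulCont f (𝒢.pullS (clopenInd hY)))
    (mulCont f (𝒢.pullS (clopenInd hY.compl)))
  rwa [← hdec] at h

variable [MeasurableSpace X] [BorelSpace X]

set_option maxHeartbeats 600000 in
/-- Two positive functionals which agree on the functions in `C_c(H)`, where they are given on `C(X)`
by a measure for which the sources of compact sets of arrows outside of `H` are null sets, agree on
`C_c(G)`. Indeed, multiplying `f ∈ C_c(G)` by the characteristic function of a small clopen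
neighbourhood of these sources changes the values by a small amount, and by an element of
`C_c(H)`. -/
lemma IsCantor.eq_of_eq_extendZero (hG : 𝒢.IsCantor) (H : 𝒢.WideSubgroupoid)
    (hH : IsOpen H.carrier) (μ : Measure X) [IsFiniteMeasure μ]
    (hμ : ∀ K : Set G, IsCompact K → K ⊆ H.carrierᶜ → μ (𝒢.s '' K) = 0)
    (τ σ : 𝒢.reducedCStar →ₗ[ℂ] ℂ) (hτ : ∀ a, 0 ≤ τ (star a * a)) (hσ : ∀ a, 0 ≤ σ (star a * a))
    (heq : ∀ f : C_c(H.carrier, ℂ), τ (𝒢.toReduced (H.extendZero hG.t2Space hH f)) =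
      σ (𝒢.toReduced (H.extendZero hG.t2Space hH f)))
    (hσμ : ∀ g : C(X, ℂ), σ (𝒢.toReduced (hG.diag g)) = ∫ x, g x ∂μ) (f : C_c(G, ℂ)) :
    τ (𝒢.toReduced f) = σ (𝒢.toReduced f) := by
  have hT2 := hG.t2Space
  have := hG.t2Space_unit
  have := hG.compactSpace
  have := hG.totallyDisconnectedSpace
  have := hG.secondCountable_unit
  have := TopologicalSpace.metrizableSpace_of_t3_secondCountable X
  let K : Set G := tsupport f ∩ H.carrierᶜ
  have hK : IsCompact K := f.hasCompactSupport.isCompact.inter_right hH.isClosed_compl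
  let B : ℝ := 2 * (‖τ (𝒢.toReduced f * star (𝒢.toReduced f))‖ +
    ‖σ (𝒢.toReduced f * star (𝒢.toReduced f))‖)
  have hB : 0 ≤ B := by positivity
  refine eq_of_forall_norm_sub_sq_le (B := B) fun ε hε => ?_
  obtain ⟨Y, hY, hKY, hYε⟩ := exists_isClopen_measureReal_lt μ (hK.image 𝒢.continuous_s)
    (hμ K hK Set.inter_subset_right) hε
  have hYσ : ‖σ (𝒢.toReduced (hG.diag (clopenInd hY)))‖ = μ.real Y := by
    rw [hσμ]
    have h1 : ∫ x, clopenInd hY x ∂μ = ((μ.real Y : ℝ) : ℂ) := by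
      change ∫ x, Y.indicator (1 : X → ℂ) x ∂μ = _
      rw [integral_indicator hY.1.measurableSet]
      simp
    rw [h1, Complex.norm_real, Real.norm_of_nonneg measureReal_nonneg]
  have hYτ : ‖τ (𝒢.toReduced (hG.diag (clopenInd hY)))‖ = μ.real Y := by
    obtain ⟨f₀, hf₀⟩ := hG.exists_extendZero_eq_diag H hH (clopenInd hY)
    rw [← hYσ, ← hf₀, heq]
  obtain ⟨f₀, hf₀⟩ := exists_extendZero_eq H hT2 hH (mulCont f (𝒢.pullS (clopenInd hY.compl)))
    (K := tsupport f ∩ (𝒢.s ⁻¹' Y)ᶜ)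
    (f.hasCompactSupport.isCompact.inter_right (hY.preimage 𝒢.continuous_s).compl.1)
    (fun g hg => by
      by_contra hgH
      exact hg.2 (hKY ⟨g, ⟨hg.1, hgH⟩, rfl⟩))
    (fun g hg => by
      by_contra hne
      rw [mulCont_apply] at hne
      refine hg ⟨subset_tsupport _ (left_ne_zero_of_mul hne), fun hgY => ?_⟩
      exact right_ne_zero_of_mul hne (clopenInd_of_notMem hY.compl (not_not.2 hgY)))
  have hdiff : τ (𝒢.toReduced f) - σ (𝒢.toReduced f) =
      τ (𝒢.toReduced (mulCont f (𝒢.pullS (clopenInd hY)))) -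
        σ (𝒢.toReduced (mulCont f (𝒢.pullS (clopenInd hY)))) := by
    rw [map_toReduced_eq_add τ f hY, map_toReduced_eq_add σ f hY, ← hf₀, heq f₀,
      add_sub_add_right_eq_sub]
  have h1 := hG.norm_sq_mulCont_le τ hτ f hY
  have h2 := hG.norm_sq_mulCont_le σ hσ f hY
  rw [hYτ] at h1
  rw [hYσ] at h2
  rw [hdiff]
  refine (norm_sub_sq_le_of_le h1 h2).trans ?_
  gcongr
/-- A unital *-homomorphism restricts normalized traces. -/
def restrictTrace {A B : Type*} [Ring A] [StarRing A] [Algebra ℂ A] [Ring B] [StarRing B]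
    [Algebra ℂ B] (ι : A →⋆ₐ[ℂ] B) (τ : NormalizedTrace B) : NormalizedTrace A :=
  ⟨τ.1.comp ι.toAlgHom.toLinearMap,
    { nonneg := fun a => by
        have h := τ.2.nonneg (ι a)
        rwa [← map_star, ← map_mul] at h
      map_mul_comm := fun a b => by
        have h := τ.2.map_mul_comm (ι a) (ι b)
        rwa [← map_mul, ← map_mul] at h
      map_one := by
        have h := τ.2.map_one
        rwa [← map_one ι] at h }⟩

lemma restrictTrace_apply {A B : Type*} [Ring A] [StarRing A] [Algebra ℂ A] [Ring B] [StarRing B]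
    [Algebra ℂ B] (ι : A →⋆ₐ[ℂ] B) (τ : NormalizedTrace B) (a : A) :
    (restrictTrace ι τ).1 a = τ.1 (ι a) := rfl

/-- If every trace of `H` comes from an invariant measure, then so does every trace of `G`. -/
lemma IsCantor.measureToTrace_surjective (hG : 𝒢.IsCantor) (H : 𝒢.WideSubgroupoid)
    (hH : IsOpen H.carrier) (hH' : H.toGroupoid.IsCantor)
    (hthin : ∀ K : Set G, IsCompact K → K ⊆ H.carrierᶜ → H.toGroupoid.IsThin (𝒢.s '' K))
    (hsurj : Function.Surjective hH'.measureToTrace)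
    (ι : H.toGroupoid.reducedCStar →⋆ₐ[ℂ] 𝒢.reducedCStar)
    (hι : ∀ f : C_c(H.carrier, ℂ),
      ι (H.toGroupoid.toReduced f) = 𝒢.toReduced (H.extendZero hG.t2Space hH f)) :
    Function.Surjective hG.measureToTrace := by
  intro τ
  obtain ⟨μ, hμ⟩ := hsurj (restrictTrace ι τ)
  refine hG.exists_measureToTrace_eq τ μ.1 fun f => ?_
  rw [← hG.traceOf_toReduced]
  refine hG.eq_of_eq_extendZero H hH (μ.1 : Measure X)
    (fun K hK hK' => hH'.measure_eq_zero_of_isThin _ μ.2 (hthin K hK hK')) τ.1 _ τ.2.nonneg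
    (hG.traceOf_nonneg _) (fun f => ?_) (fun g => ?_) f
  · have h1 := hH'.traceOf_toReduced (μ.1 : Measure X) f
    rw [← hH'.measureToTrace_apply, hμ, restrictTrace_apply, hι] at h1
    rw [h1, hG.traceOf_toReduced]
    exact integral_congr_ae (.of_forall fun x =>
      (extendZero_apply H hG.t2Space hH f (H.toGroupoid.unit x)).symm)
  · rw [hG.traceOf_toReduced]
    simp only [hG.diag_unit]

/-- The square formed by the measures and traces of `G` and `H` commutes. -/
lemma IsCantor.restrictTrace_measureToTrace (hG : 𝒢.IsCantor) (H : 𝒢.WideSubgroupoid)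
    (hH : IsOpen H.carrier) (hH' : H.toGroupoid.IsCantor)
    (ι : H.toGroupoid.reducedCStar →⋆ₐ[ℂ] 𝒢.reducedCStar)
    (hι : ∀ f : C_c(H.carrier, ℂ),
      ι (H.toGroupoid.toReduced f) = 𝒢.toReduced (H.extendZero hG.t2Space hH f))
    (μ : 𝒢.InvariantProbability) :
    restrictTrace ι (hG.measureToTrace μ) = hH'.measureToTrace
      ⟨μ.1, isInvariant_toGroupoid H hG.t2Space hH _ μ.2⟩ := by
  refine Subtype.ext (hH'.eq_traceOf (μ.1 : Measure X) (restrictTrace ι _).2 fun f => ?_)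
  rw [restrictTrace_apply, hι, hG.measureToTrace_apply, hG.traceOf_toReduced]
  exact integral_congr_ae (.of_forall fun x =>
    extendZero_apply H hG.t2Space hH f (H.toGroupoid.unit x))

end RDiscreteGroupoid

set_option maxHeartbeats 600000 in
theorem proposition2p12 {X G : Type*} [TopologicalSpace X] [MeasurableSpace X] [BorelSpace X]
    [TopologicalSpace G] (𝒢 : RDiscreteGroupoid X G) (hG : 𝒢.IsCantor)
    (G₀ : 𝒢.WideSubgroupoid) (hopen : IsOpen G₀.carrier) (hAF : G₀.toGroupoid.IsAF)
    (hthin : ∀ K : Set G, IsCompact K → K ⊆ G₀.carrierᶜ → G₀.toGroupoid.IsThin (𝒢.s '' K)) :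
    -- the inclusion of the reduced C*-algebras induced by `C_c(G₀) ⊆ C_c(G)`
    ∃ ι : G₀.toGroupoid.reducedCStar →⋆ₐ[ℂ] 𝒢.reducedCStar,
      Function.Injective ι ∧
      (∀ f : C_c(G₀.carrier, ℂ),
        ι (G₀.toGroupoid.toReduced f) = 𝒢.toReduced (G₀.extendZero hG.t2Space hopen f)) ∧
    -- the four canonical bijections
    ∃ (j : 𝒢.InvariantProbability ≃ G₀.toGroupoid.InvariantProbability)
      (ρ : NormalizedTrace 𝒢.reducedCStar ≃ NormalizedTrace G₀.toGroupoid.reducedCStar)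
      (T : 𝒢.InvariantProbability ≃ NormalizedTrace 𝒢.reducedCStar)
      (T₀ : G₀.toGroupoid.InvariantProbability ≃ NormalizedTrace G₀.toGroupoid.reducedCStar),
      (∀ μ, (j μ).1 = μ.1) ∧
      (∀ τ a, (ρ τ).1 a = τ.1 (ι a)) ∧
      (∀ μ (f : C_c(G, ℂ)),
        (T μ).1 (𝒢.toReduced f) = ∫ x, f (𝒢.unit x) ∂(μ.1 : Measure X)) ∧
      (∀ μ (f : C_c(G₀.carrier, ℂ)),
        (T₀ μ).1 (G₀.toGroupoid.toReduced f) =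
          ∫ x, f (G₀.toGroupoid.unit x) ∂(μ.1 : Measure X)) ∧
      ∀ μ, ρ (T μ) = T₀ (j μ) := by
  have hG₀ : G₀.toGroupoid.IsCantor := hAF.1
  obtain ⟨ι, hι, hιf⟩ := G₀.exists_inclusion hG.t2Space hopen
  refine ⟨ι, hι, hιf, ?_⟩
  let j : 𝒢.InvariantProbability ≃ G₀.toGroupoid.InvariantProbability :=
    { toFun := fun μ => ⟨μ.1, RDiscreteGroupoid.isInvariant_toGroupoid G₀ hG.t2Space hopen _ μ.2⟩
      invFun := fun μ =>
        ⟨μ.1, RDiscreteGroupoid.isInvariant_of_toGroupoid G₀ hG hopen hAF hthin _ μ.2⟩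
      left_inv := fun _ => rfl
      right_inv := fun _ => rfl }
  have hsurj₀ := hG₀.measureToTrace_surjective_of_principal
    (RDiscreteGroupoid.isPrincipal_of_isAF hAF)
  let T₀ := Equiv.ofBijective hG₀.measureToTrace ⟨hG₀.measureToTrace_injective, hsurj₀⟩
  let T := Equiv.ofBijective hG.measureToTrace ⟨hG.measureToTrace_injective,
    hG.measureToTrace_surjective G₀ hopen hG₀ hthin hsurj₀ ι hιf⟩
  have hsq : ∀ μ, RDiscreteGroupoid.restrictTrace ι (T μ) = T₀ (j μ) :=
    hG.restrictTrace_measureToTrace G₀ hopen hG₀ ι hιf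
  -- Commutativity of the square identifies the restriction map with a composition of bijections.
  refine ⟨j, (T.symm.trans j).trans T₀, T, T₀, fun μ => rfl, fun τ a => ?_,
    fun μ f => hG.traceOf_toReduced _ f, fun μ f => hG₀.traceOf_toReduced _ f, fun μ => ?_⟩
  · have h := hsq (T.symm τ)
    rw [Equiv.apply_symm_apply] at h
    rw [← RDiscreteGroupoid.restrictTrace_apply, h]
    rfl
  · exact congrArg (fun ν => T₀ (j ν)) (T.symm_apply_apply μ)
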